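/- \textbf{Setting.} Let $(G,P)$ be a quasi-lattice ordered group: $G$ is a discrete group, $P\subseteq G$ is a submonoid with $P\cap P^{-1}=\{e\}$, and, for the partial order $p\le q \Leftrightarrow p^{-1}q\in P$ on $G$, any two elements $p,q\in G$ with a common upper bound in $P$ have a least common upper bound $p\vee q$ in $P$. A \emph{$P$-graph} $(\Lambda,d)$ is a countable category $\Lambda$ (we write $\lambda\in\Lambda$ for its morphisms, and $r(\lambda)$, $s(\lambda)$ for the codomain and domain of $\lambda$, with objects identified with their identity morphisms) together with a functor $d:\Lambda\to P$ such that, whenever $d(\lambda)=pq$ with $p,q\in P$, there are unique $\mu,\nu\in\Lambda$ with $\lambda=\mu\nu$, $d(\mu)=p$ and $d(\nu)=q$. For $\mu,\nu\in\Lambda$, let $\mathrm{MCE}(\mu,\nu)$ be the set of all $\lambda\in\Lambda$ such that $d(\mu)\vee d(\nu)$ exists, $d(\lambda)=d(\mu)\vee d(\nu)$, and $\lambda=\mu\alpha=\nu\beta$ for some $\alpha,\beta\in\Lambda$. $\Lambda$ is \emph{finitely aligned} if every $\mathrm{MCE}(\mu,\nu)$ is finite. For an object $v$ put $v\Lambda=\{\lambda\in\Lambda: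 r(\lambda)=v\}$; a set $E\subseteq v\Lambda$ is \emph{exhaustive} if for every $\mu\in v\Lambda$ there is $\lambda\in E$ with $\mathrm{MCE}(\mu,\lambda)\neq\emptyset$. Write \[ \Lambda *_{d,s}\Lambda=\{(\mu,\nu)\in\Lambda\times\Lambda : s(\mu)=s(\nu),\ d(\mu)=d(\nu)\} \] for the set of balanced pairs. A \emph{representation} of $\Lambda *_{d,s}\Lambda$ in a (not necessarily unital) $C^*$-algebra $B$ is a map $\tau:\Lambda *_{d,s}\Lambda\to B$, $(\mu,\nu)\mapsto\tau_{\mu,\nu}$, such that for all balanced pairs $(\mu,\nu)$, $(\xi,\eta)$ \[ \tau_{\mu,\nu}^*=\tau_{\nu,\mu} \qquad\text{and}\qquad \tau_{\mu,\nu}\tau_{\xi,\eta}=\sum_{\nu\alpha=\xi\beta\in\mathrm{MCE}(\nu,\xi)}\tau_{\mu\alpha,\eta\beta}. \] $C^*(\tau)$ denotes the $C^*$-subalgebra of $B$ generated by all $\tau_{\mu,\nu}$. Homomorphisms of $C^*$-algebras are $*$-homomorphisms. \textbf{Theorem.} Let $(G,P)$ be a quasi-lattice ordered group and let $(\Lambda,d)$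 be a finitely aligned $P$-graph. There is a $C^*$-algebra $\mathcal{B}_{\min}(\Lambda)$ generated by a representation $\Omega$ of $\Lambda *_{d,s}\Lambda$ such that: \begin{enumerate} \item[(1)] each $\Omega_{\mu,\nu}$ is nonzero; and \item[(2)] given any representation $\tau$ of $\Lambda *_{d,s}\Lambda$ in a $C^*$-algebra with each $\tau_{\mu,\nu}$ nonzero, there is a homomorphism $\phi_\tau: C^*(\tau)\to\mathcal{B}_{\min}(\Lambda)$ satisfying $\phi_\tau(\tau_{\mu,\nu})=\Omega_{\mu,\nu}$ for all $(\mu,\nu)\in\Lambda *_{d,s}\Lambda$. \end{enumerate} Moreover, $\mathcal{B}_{\min}(\Lambda)$ is unique up to canonical isomorphism: if a $C^*$-algebra $B'$ generated by a representation $\Omega'$ of $\Lambda *_{d,s}\Lambda$ also satisfies (1) and (2), then there is a unique isomorphism $\mathcal{B}_{\min}(\Lambda)\to B'$ carrying each $\Omega_{\mu,\nu}$ to $\Omega'_{\mu,\nu}$. Finally, given a representation $\tau$ as in (2), the homomorphism $\phi_\tau$ is injective if and only if \[ \prod_{\alpha\in E}(\tau_{\mu,\mu}-\tau_{\mu\alpha,\mu\alpha})=0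 \quad\text{for every }\mu\in\Lambda\text{ and every finite exhaustive subset }E\subseteq s(\mu)\Lambda. \] -/

import Mathlib

open CategoryTheory

universe g u v w

namespace BalancedPGraph

/-! ### Quasi-lattice ordered groups -/

section QuasiLattice

variable {G : Type g} [Group G]

/-- The left-invariant relation `p ≤ q ↔ p⁻¹ q ∈ P` on `G`. -/
def Le (P : Submonoid G) (p q : G) : Prop := p⁻¹ * q ∈ P

/-- `r = p ∨ q`: the element `r` is a least element among the common upper bounds of `p` and `q`
that lie in `P`. -/
structure IsJoin (P : Submonoid G) (p q r : G) : Prop where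
  mem : r ∈ P
  left : Le P p r
  right : Le P q r
  least : ∀ t ∈ P, Le P p t → Le P q t → Le P r t

/-- `(G, P)` is a quasi-lattice ordered group. -/
structure IsQuasiLatticeOrdered (P : Submonoid G) : Prop where
  /-- `P ∩ P⁻¹ = {e}`. -/
  eq_one : ∀ p ∈ P, p⁻¹ ∈ P → p = 1
  /-- Any two elements of `G` with a common upper bound in `P` have a least one. -/
  exists_join : ∀ p q : G, (∃ t ∈ P, Le P p t ∧ Le P q t) → ∃ r, IsJoin P p q r

end QuasiLattice

/-! ### `P`-graphs

The path category has object type `Λ`. A path `μ` with source `s(μ) = v` and range `r(μ) = w` is a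
morphism `μ : v ⟶ w` (domain `v`, codomain `w`), so the product `μα` of paths (the composite of
`μ` after `α`, defined when `s(μ) = r(α)`) is `α ≫ μ` in Mathlib's notation. The degree map is a
functor to the one-object category of the monoid `P`, in which `f ≫ g = g * f`; hence
`d(μα) = d(μ)d(α)`. The set of all paths is `Arrow Λ`. Vertices are identified with objects. -/

section Graph

variable {G : Type g} [Group G] {P : Submonoid G} {Λ : Type u} [Category.{v} Λ]

/-- The degree `d(μ)`, as an element of `G`. -/
def deg (d : Λ ⥤ SingleObj P) {x y : Λ} (μ : x ⟶ y) : G :=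
  ((show P from d.map μ) : G)

theorem deg_comp (d : Λ ⥤ SingleObj P) {x y z : Λ} (α : x ⟶ y) (μ : y ⟶ z) :
    deg d (α ≫ μ) = deg d μ * deg d α := by
  unfold deg
  rw [d.map_comp]
  rfl

theorem deg_mem (d : Λ ⥤ SingleObj P) {x y : Λ} (μ : x ⟶ y) : deg d μ ∈ P :=
  (show P from d.map μ).2

/-- A countable category with a degree functor to `P` is a `P`-graph if it has the factorisation
property: a path `l` with `d(l) = pq` can be written in exactly one way as `l = μν` with
`d(μ) = p` and `d(ν) = q`. -/
structure IsPGraph (d : Λ ⥤ SingleObj P) : Prop where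
  countable : CountableCategory Λ
  factorisation : ∀ {x y : Λ} (l : x ⟶ y) (p q : G), p ∈ P → q ∈ P → deg d l = p * q →
    ∃! t : (z : Λ) × (z ⟶ y) × (x ⟶ z),
      t.2.2 ≫ t.2.1 = l ∧ deg d t.2.1 = p ∧ deg d t.2.2 = q

/-- `μ ⪯ l`, that is, `l = μα` for some path `α`. -/
def Prefix (μ l : Arrow Λ) : Prop :=
  ∃ (z : Λ) (α : z ⟶ μ.left), l = Arrow.mk (α ≫ μ.hom)

/-- The set `MCE(μ, ν)` of minimal common extensions: the paths `l = μα = νβ` of degree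
`d(μ) ∨ d(ν)`. (It is empty if `d(μ) ∨ d(ν) = ∞`, and the degrees of `α` and `β` are determined by
`l = μα = νβ`.) -/
def MCE (d : Λ ⥤ SingleObj P) (μ ν : Arrow Λ) : Set (Arrow Λ) :=
  {l | IsJoin P (deg d μ.hom) (deg d ν.hom) (deg d l.hom) ∧ Prefix μ l ∧ Prefix ν l}

/-- All sets of minimal common extensions are finite. -/
def FinitelyAligned (d : Λ ⥤ SingleObj P) : Prop :=
  ∀ μ ν : Arrow Λ, (MCE d μ ν).Finite

/-- The set `vΛ` of paths with range `v`. -/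
abbrev PathsTo (v : Λ) : Type (max u v) := (z : Λ) × (z ⟶ v)

/-- A finite set `E ⊆ vΛ` is exhaustive if every path in `vΛ` has a minimal common extension with
some member of `E`. -/
def Exhaustive (d : Λ ⥤ SingleObj P) {v : Λ} (E : Finset (PathsTo v)) : Prop :=
  ∀ μ : PathsTo v, ∃ l ∈ E, (MCE d (Arrow.mk μ.2) (Arrow.mk l.2)).Nonempty

/-- The balanced pairs: pairs `(μ, ν)` of paths with `s(μ) = s(ν)` and `d(μ) = d(ν)`. -/
structure BalPair (d : Λ ⥤ SingleObj P) where
  /-- the common source -/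
  src : Λ
  /-- the range of the first path -/
  rng₁ : Λ
  /-- the range of the second path -/
  rng₂ : Λ
  fst : src ⟶ rng₁
  snd : src ⟶ rng₂
  deg_eq : deg d fst = deg d snd

/-- The pair `(μ, μ)`. -/
def diag (d : Λ ⥤ SingleObj P) {x y : Λ} (μ : x ⟶ y) : BalPair d := ⟨x, y, y, μ, μ, rfl⟩

/-- The pair `(ν, μ)`. -/
def BalPair.swap {d : Λ ⥤ SingleObj P} (p : BalPair d) : BalPair d :=
  ⟨p.src, p.rng₂, p.rng₁, p.snd, p.fst, p.deg_eq.symm⟩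

/-- The index set of the sum over `να = ξβ ∈ MCE(ν, ξ)`: pairs of paths `(α, β)` such that
`να = ξβ ∈ MCE(ν, ξ)`. -/
structure MCEIndex (d : Λ ⥤ SingleObj P) {x y x' y' : Λ} (ν : x ⟶ y) (ξ : x' ⟶ y') where
  src : Λ
  α : src ⟶ x
  β : src ⟶ x'
  eq : Arrow.mk (α ≫ ν) = Arrow.mk (β ≫ ξ)
  mem : Arrow.mk (α ≫ ν) ∈ MCE d (Arrow.mk ν) (Arrow.mk ξ)

theorem deg_eq_of_mk_eq (d : Λ ⥤ SingleObj P) {x y x' y' : Λ} {μ : x ⟶ y} {ν : x' ⟶ y'}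
    (h : Arrow.mk μ = Arrow.mk ν) : deg d μ = deg d ν :=
  congrArg (fun a : Arrow Λ => deg d a.hom) h

/-- The pair `(μα, ηβ)` attached to balanced pairs `(μ, ν)`, `(ξ, η)` and `να = ξβ ∈ MCE(ν, ξ)`. -/
def MCEIndex.pair {d : Λ ⥤ SingleObj P} {p q : BalPair d} (i : MCEIndex d p.snd q.fst) :
    BalPair d where
  src := i.src
  rng₁ := p.rng₁
  rng₂ := q.rng₂
  fst := i.α ≫ p.fst
  snd := i.β ≫ q.snd
  deg_eq := by
    have h := deg_eq_of_mk_eq d i.eq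
    rw [deg_comp, deg_comp] at h
    rw [deg_comp, deg_comp, p.deg_eq, h, q.deg_eq]

/-- In a `P`-graph a path `να` determines `α`; so `(α, β) ↦ να` is injective on the index set. -/
theorem IsPGraph.mceIndex_injective {d : Λ ⥤ SingleObj P} (hd : IsPGraph d) {x y x' y' : Λ}
    (ν : x ⟶ y) (ξ : x' ⟶ y') :
    Function.Injective (fun i : MCEIndex d ν ξ => Arrow.mk (i.α ≫ ν)) := by
  have key : ∀ {z x y : Λ} (μ : x ⟶ y) (α α' : z ⟶ x), α ≫ μ = α' ≫ μ → α = α' := by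
    intro z x y μ α α' h
    have h' : deg d α = deg d α' := by
      have := congrArg (deg d) h
      rw [deg_comp, deg_comp] at this
      exact mul_left_cancel this
    have := (hd.factorisation (α ≫ μ) (deg d μ) (deg d α) (deg_mem d _) (deg_mem d _)
      (deg_comp d _ _)).unique (y₁ := ⟨x, μ, α⟩) (y₂ := ⟨x, μ, α'⟩) ⟨rfl, rfl, rfl⟩
      ⟨h.symm, rfl, h'.symm⟩
    simpa using this
  rintro ⟨s, α, β, e, m⟩ ⟨s', α', β', e', m'⟩ h
  obtain rfl : s = s' := congrArg (fun a : Arrow Λ => a.left) h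
  have h1 : α ≫ ν = α' ≫ ν := Arrow.mk_injective _ _ h
  have h2 : β ≫ ξ = β' ≫ ξ := Arrow.mk_injective _ _ (e.symm.trans (h.trans e'))
  obtain rfl := key ν _ _ h1
  obtain rfl := key ξ _ _ h2
  rfl

/-- In a finitely aligned `P`-graph the sums in `BalRep.mul_eq` below are finite. -/
theorem IsPGraph.finite_mceIndex {d : Λ ⥤ SingleObj P} (hd : IsPGraph d)
    (hfa : FinitelyAligned d) {x y x' y' : Λ} (ν : x ⟶ y) (ξ : x' ⟶ y') :
    Finite (MCEIndex d ν ξ) := by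
  have := (hfa (Arrow.mk ν) (Arrow.mk ξ)).to_subtype
  exact Finite.of_injective
    (fun i : MCEIndex d ν ξ => (⟨Arrow.mk (i.α ≫ ν), i.mem⟩ : MCE d (Arrow.mk ν) (Arrow.mk ξ)))
    fun i j h => hd.mceIndex_injective ν ξ (congrArg Subtype.val h)

end Graph

/-! ### Representations of the balanced pairs -/

section Representations

variable {G : Type g} [Group G] {P : Submonoid G} {Λ : Type u} [Category.{v} Λ]

/-- A representation of the balanced pairs in a `C*`-algebra `B`. -/
structure BalRep (d : Λ ⥤ SingleObj P) (B : Type w) [NonUnitalCStarAlgebra B] where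
  /-- the elements `τ_{μ,ν}` -/
  toFun : BalPair d → B
  /-- `τ_{μ,ν}^* = τ_{ν,μ}`. -/
  star_eq : ∀ p, star (toFun p) = toFun p.swap
  /-- `τ_{μ,ν} τ_{ξ,η} = ∑ τ_{μα,ηβ}`, the sum being over `να = ξβ ∈ MCE(ν, ξ)`. -/
  mul_eq : ∀ p q, toFun p * toFun q = ∑ᶠ i : MCEIndex d p.snd q.fst, toFun i.pair

namespace BalRep

variable {d : Λ ⥤ SingleObj P} {B : Type w} [NonUnitalCStarAlgebra B]

/-- `C*(τ)`: the smallest closed `*`-subalgebra containing all `τ_{μ,ν}`. -/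
def cstar (τ : BalRep d B) : NonUnitalStarSubalgebra ℂ B :=
  (NonUnitalStarAlgebra.adjoin ℂ (Set.range τ.toFun)).topologicalClosure

theorem mem_cstar (τ : BalRep d B) (p : BalPair d) : τ.toFun p ∈ τ.cstar :=
  NonUnitalStarSubalgebra.le_topologicalClosure _
    (NonUnitalStarAlgebra.subset_adjoin ℂ _ (Set.mem_range_self p))

/-- `τ_{μ,ν}` as an element of `C*(τ)`. -/
def gen (τ : BalRep d B) (p : BalPair d) : τ.cstar := ⟨τ.toFun p, τ.mem_cstar p⟩

/-- `B` is generated as a `C*`-algebra by the representation. -/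
def Generates (τ : BalRep d B) : Prop := τ.cstar = ⊤

/-- Every `τ_{μ,ν}` is nonzero. -/
def Nonvanishing (τ : BalRep d B) : Prop := ∀ p, τ.toFun p ≠ 0

theorem diag_mul_comm (τ : BalRep d B) {x y x' y' : Λ} (μ : x ⟶ y) (ν : x' ⟶ y') :
    τ.toFun (diag d μ) * τ.toFun (diag d ν) = τ.toFun (diag d ν) * τ.toFun (diag d μ) := by
  have hmem : ∀ a b c : Arrow Λ, a ∈ MCE d b c → a ∈ MCE d c b := fun a b c h =>
    ⟨⟨h.1.mem, h.1.right, h.1.left, fun t ht h1 h2 => h.1.least t ht h2 h1⟩, h.2.2, h.2.1⟩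
  have hpair : ∀ {z x y x' y' : Λ} (l : z ⟶ y) (l' : z ⟶ y') (h : deg d l = deg d l')
      (h' : deg d l' = deg d l), Arrow.mk l = Arrow.mk l' →
      (⟨z, y, y', l, l', h⟩ : BalPair d) = ⟨z, y', y, l', l, h'⟩ := by
    intro z x y x' y' l l' h h' e
    obtain rfl : y = y' := congrArg (fun a : Arrow Λ => a.right) e
    obtain rfl : l = l' := Arrow.mk_injective _ _ e
    rfl
  rw [τ.mul_eq, τ.mul_eq]
  let e : MCEIndex d (diag d μ).snd (diag d ν).fst ≃ MCEIndex d (diag d ν).snd (diag d μ).fst :=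
    { toFun := fun i => ⟨i.src, i.β, i.α, i.eq.symm, by
        have := hmem _ _ _ i.mem
        rwa [i.eq] at this⟩
      invFun := fun i => ⟨i.src, i.β, i.α, i.eq.symm, by
        have := hmem _ _ _ i.mem
        rwa [i.eq] at this⟩
      left_inv := fun _ => rfl
      right_inv := fun _ => rfl }
  refine finsum_eq_of_bijective e e.bijective fun i => ?_
  exact congrArg τ.toFun (hpair (x := x) (x' := x) _ _ _ _ i.eq)

/-- The element `τ_{μ,μ} - τ_{μα,μα}`. -/
def gap (τ : BalRep d B) {x y : Λ} (μ : x ⟶ y) (α : PathsTo x) : B :=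
  τ.toFun (diag d μ) - τ.toFun (diag d (α.2 ≫ μ))

theorem commute_gap (τ : BalRep d B) {x y : Λ} (μ : x ⟶ y) (α β : PathsTo x) :
    Commute (τ.gap μ α) (τ.gap μ β) := by
  have h : ∀ {x y x' y' : Λ} (μ : x ⟶ y) (ν : x' ⟶ y'),
      Commute (τ.toFun (diag d μ)) (τ.toFun (diag d ν)) := fun μ ν => τ.diag_mul_comm μ ν
  exact ((h _ _).sub_right (h _ _)).sub_left ((h _ _).sub_right (h _ _))

/-- The product `∏_{α ∈ E} (τ_{μ,μ} - τ_{μα,μα})`. The factors commute, so their order is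
immaterial. As `B` need not have a unit, the product is formed in the unitization of `B` (it lies in
`B` as soon as `E` is nonempty; exhaustive sets are nonempty). -/
noncomputable def gapProd (τ : BalRep d B) {x y : Λ} (μ : x ⟶ y) (E : Finset (PathsTo x)) :
    Unitization ℂ B :=
  E.noncommProd (fun α => (τ.gap μ α : Unitization ℂ B)) fun α _ β _ _ => by
    have h := (τ.commute_gap μ α β).eq
    change (_ : Unitization ℂ B) * _ = _ * _
    rw [← Unitization.inr_mul, ← Unitization.inr_mul, h]

/-- All gap products over finite exhaustive sets vanish. -/
def GapsVanish (τ : BalRep d B) : Prop :=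
  ∀ {x y : Λ} (μ : x ⟶ y) (E : Finset (PathsTo x)), Exhaustive d E → τ.gapProd μ E = 0

end BalRep

/-- `φ : C*(τ) → B` is a `*`-homomorphism with `φ(τ_{μ,ν}) = Ω_{μ,ν}` for all balanced pairs. -/
def Intertwines {d : Λ ⥤ SingleObj P} {A B : Type*} [NonUnitalCStarAlgebra A]
    [NonUnitalCStarAlgebra B] (τ : BalRep d A) (Ω : BalRep d B) (φ : τ.cstar →⋆ₙₐ[ℂ] B) : Prop :=
  ∀ p, φ (τ.gen p) = Ω.toFun p

end Representations

end BalancedPGraph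

-- Everything rests on one criterion, `GapsVanish.exists_hom`: if the gap products of `σ` vanish and
-- all `τ_{μ,ν}` are nonzero, then `τ_{μ,ν} ↦ σ_{μ,ν}` extends to `C*(τ)`. So a nonzero
-- representation with vanishing gaps is co-universal. Injectivity follows by applying the criterion
-- with the two representations exchanged, and uniqueness from homomorphisms in both directions.
--
-- For the criterion, any finite set of paths lies in a finite set `F` closed under minimal common
-- extensions and transfer (`exists_finite_pathClosed`), so finitely many generators lie in a
-- finite-dimensional algebra. On it, a linear relation among the `τ_p` passes to the `σ_p`
-- (`GapsVanish.sum_eq_zero`). Were the combination nonzero in `σ`, cutting it on both sides by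
-- products of the projections of `F` and their complements would leave the multiples of a single
-- term, that of a pair `(m, n)`, with `m` greatest in `F` for the left cut. Vanishing gaps make the
-- proper extensions of `m` in `F` non-exhaustive, so some `mζ` avoids them all. Compressing the
-- relation in `τ` by the projections of `mζ` and `nζ` leaves the same scalar times the nonzero
-- `τ_{mζ,nζ}`; hence the scalar is zero. Injective homomorphisms of `C*`-algebras being isometric,
-- this gives norm bounds that survive closure.
--
-- Such a representation exists on `ℓ²` of the ultrafilters of paths, where `(μ, ν)` replaces an
-- initial segment `ν` by `μ`. Every path lies in an ultrafilter, so no generator vanishes; an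
-- ultrafilter containing `μ` contains `μα` for some `α` in each finite exhaustive set, so the gaps
-- vanish.

universe w'

namespace BalancedPGraph

/-! ### Quasi-lattice order and closure under joins -/

section Order

variable {G : Type g} [Group G] {P : Submonoid G}

theorem Le.refl (P : Submonoid G) (p : G) : Le P p p := by simp [Le]

theorem Le.trans {p q r : G} (h : Le P p q) (h' : Le P q r) : Le P p r := by
  have := P.mul_mem h h'
  simpa [Le, mul_assoc] using this

theorem IsQuasiLatticeOrdered.le_antisymm (hP : IsQuasiLatticeOrdered P) {p q : G}
    (h : Le P p q) (h' : Le P q p) : p = q := by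
  have := hP.eq_one _ h (by simpa [Le] using h')
  exact inv_mul_eq_one.1 this

/-- A least upper bound in `P` of a set of elements of `G`. -/
def IsLeastUpper (P : Submonoid G) (T : Set G) (r : G) : Prop :=
  r ∈ P ∧ (∀ q ∈ T, Le P q r) ∧ ∀ t ∈ P, (∀ q ∈ T, Le P q t) → Le P r t

/-- Take the least upper bounds of all subsets of `S`: there are finitely many, and a join of the
bounds of `T` and `T'` is the bound of `T ∪ T'`. -/
theorem IsQuasiLatticeOrdered.exists_finite_joinClosed (hP : IsQuasiLatticeOrdered P) {S : Set G}
    (hS : S.Finite) (hSP : S ⊆ P) :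
    ∃ D : Set G, D.Finite ∧ S ⊆ D ∧ (∀ p ∈ D, p ∈ P) ∧ ∀ p ∈ D, ∀ q ∈ D, ∀ r,
      IsJoin P p q r → r ∈ D := by
  refine ⟨{r | ∃ T ⊆ S, IsLeastUpper P T r}, ?_, ?_, ?_, ?_⟩
  · have : {r | ∃ T ⊆ S, IsLeastUpper P T r} = ⋃ T ∈ S.powerset, {r | IsLeastUpper P T r} := by
      ext; simp
    rw [this]
    refine hS.finite_subsets.biUnion fun T _ => Set.Subsingleton.finite ?_
    intro r hr r' hr'
    exact hP.le_antisymm (hr.2.2 _ hr'.1 hr'.2.1) (hr'.2.2 _ hr.1 hr.2.1)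
  · intro p hp
    exact ⟨{p}, by simpa using hp, hSP hp, by simp [Le.refl], by simp⟩
  · rintro p ⟨T, -, h⟩
    exact h.1
  · rintro p ⟨T, hT, h⟩ q ⟨T', hT', h'⟩ r hr
    refine ⟨T ∪ T', Set.union_subset hT hT', hr.mem, ?_, ?_⟩
    · rintro t (ht | ht)
      · exact (h.2.1 t ht).trans hr.left
      · exact (h'.2.1 t ht).trans hr.right
    · intro t ht h1
      exact hr.least t ht (h.2.2 t ht fun a ha => h1 a (.inl ha))
        (h'.2.2 t ht fun a ha => h1 a (.inr ha))

end Order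

/-! ### Prefixes, common extensions, and finite closed sets of paths -/

section Paths

variable {G : Type g} [Group G] {P : Submonoid G} {Λ : Type u} [Category.{v} Λ]
  {d : Λ ⥤ SingleObj P}

theorem Prefix.refl (a : Arrow Λ) : Prefix a a :=
  ⟨a.left, 𝟙 _, by simp⟩

theorem Prefix.comp {x y z : Λ} (α : z ⟶ x) (μ : x ⟶ y) :
    Prefix (Arrow.mk μ) (Arrow.mk (α ≫ μ)) :=
  ⟨z, α, rfl⟩

theorem Prefix.trans {a b c : Arrow Λ} (h : Prefix a b) (h' : Prefix b c) : Prefix a c := by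
  obtain ⟨z, α, rfl⟩ := h
  obtain ⟨z', β, rfl⟩ := h'
  exact ⟨z', β ≫ α, by simp⟩

theorem Prefix.deg_le (d : Λ ⥤ SingleObj P) {a b : Arrow Λ} (h : Prefix a b) :
    Le P (deg d a.hom) (deg d b.hom) := by
  obtain ⟨z, α, rfl⟩ := h
  change Le P (deg d a.hom) (deg d (α ≫ a.hom))
  rw [deg_comp, Le, inv_mul_cancel_left]
  exact deg_mem d α

theorem IsPGraph.factor_unique (hd : IsPGraph d) {z x x' y : Λ} {α : z ⟶ x} {μ : x ⟶ y}
    {β : z ⟶ x'} {ν : x' ⟶ y} (h : α ≫ μ = β ≫ ν) (h' : deg d μ = deg d ν) :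
    (⟨x, μ, α⟩ : (x : Λ) × (x ⟶ y) × (z ⟶ x)) = ⟨x', ν, β⟩ := by
  have h2 : deg d β = deg d α := by
    have := congrArg (deg d) h
    rw [deg_comp, deg_comp, h'] at this
    exact (mul_left_cancel this).symm
  exact (hd.factorisation (α ≫ μ) (deg d μ) (deg d α) (deg_mem d _) (deg_mem d _)
    (deg_comp d _ _)).unique (y₁ := ⟨x, μ, α⟩) (y₂ := ⟨x', ν, β⟩) ⟨rfl, rfl, rfl⟩
      ⟨h.symm, h'.symm, h2⟩

theorem IsPGraph.left_cancel (hd : IsPGraph d) {z x y : Λ} {μ : x ⟶ y} {α β : z ⟶ x}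
    (h : α ≫ μ = β ≫ μ) : α = β := by
  simpa using hd.factor_unique h rfl

theorem IsPGraph.left_cancel_mk (hd : IsPGraph d) {z z' x y : Λ} {μ : x ⟶ y} {α : z ⟶ x}
    {β : z' ⟶ x} (h : Arrow.mk (α ≫ μ) = Arrow.mk (β ≫ μ)) : Arrow.mk α = Arrow.mk β := by
  obtain rfl : z = z' := congrArg (fun a : Arrow Λ => a.left) h
  rw [hd.left_cancel (Arrow.mk_injective _ _ h)]

theorem mk_comp_congr {z z' x y : Λ} (μ : x ⟶ y) {α : z ⟶ x}
    {β : z' ⟶ x} (h : Arrow.mk α = Arrow.mk β) : Arrow.mk (α ≫ μ) = Arrow.mk (β ≫ μ) := by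
  obtain rfl : z = z' := congrArg (fun a : Arrow Λ => a.left) h
  rw [Arrow.mk_injective _ _ h]

theorem IsPGraph.prefix_eq (hd : IsPGraph d) {a b c : Arrow Λ} (ha : Prefix a c) (hb : Prefix b c)
    (h : deg d a.hom = deg d b.hom) : a = b := by
  obtain ⟨z, α, rfl⟩ := ha
  obtain ⟨z', β, e⟩ := hb
  obtain ⟨x, y, μ⟩ := a
  obtain ⟨x', y', ν⟩ := b
  change z ⟶ x at α
  change z' ⟶ x' at β
  change x ⟶ y at μ
  change x' ⟶ y' at ν
  change Arrow.mk (α ≫ μ) = Arrow.mk (β ≫ ν) at e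
  obtain rfl : z = z' := congrArg (fun a : Arrow Λ => a.left) e
  obtain rfl : y = y' := congrArg (fun a : Arrow Λ => a.right) e
  have := hd.factor_unique (Arrow.mk_injective _ _ e) h
  exact congrArg (fun t : (x : Λ) × (x ⟶ y) × (z ⟶ x) => Arrow.mk t.2.1) this

theorem IsPGraph.exists_prefix (hd : IsPGraph d) {c : Arrow Λ} {r : G} (hr : r ∈ P)
    (h : Le P r (deg d c.hom)) : ∃ a : Arrow Λ, Prefix a c ∧ deg d a.hom = r := by
  obtain ⟨⟨z, μ, α⟩, ⟨h1, h2, -⟩, -⟩ :=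
    hd.factorisation c.hom r (r⁻¹ * deg d c.hom) hr h (by simp)
  dsimp at h1 h2
  exact ⟨Arrow.mk μ, ⟨_, α, by dsimp; rw [h1]; rfl⟩, h2⟩

theorem IsPGraph.prefix_of_le (hd : IsPGraph d) {a b c : Arrow Λ} (ha : Prefix a c)
    (hb : Prefix b c) (h : Le P (deg d a.hom) (deg d b.hom)) : Prefix a b := by
  obtain ⟨a', h1, h2⟩ := hd.exists_prefix (deg_mem d a.hom) h
  rwa [← hd.prefix_eq (h1.trans hb) ha h2]

theorem Prefix.antisymm (hP : IsQuasiLatticeOrdered P) (hd : IsPGraph d) {a b : Arrow Λ}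
    (h : Prefix a b) (h' : Prefix b a) : a = b :=
  hd.prefix_eq h (.refl b) (hP.le_antisymm (h.deg_le d) (h'.deg_le d))

/-- Two paths are compatible if they have a common extension. -/
def Compat (a b : Arrow Λ) : Prop := ∃ c, Prefix a c ∧ Prefix b c

theorem Compat.symm {a b : Arrow Λ} (h : Compat a b) : Compat b a :=
  let ⟨c, h1, h2⟩ := h; ⟨c, h2, h1⟩

theorem Compat.mono {a b a' b' : Arrow Λ} (h : Compat a b) (ha : Prefix a' a) (hb : Prefix b' b) :
    Compat a' b' :=
  let ⟨c, h1, h2⟩ := h; ⟨c, ha.trans h1, hb.trans h2⟩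

theorem compat_of_mem_MCE {a b c : Arrow Λ} (h : c ∈ MCE d a b) : Compat a b := ⟨c, h.2⟩

/-- The prefix of `c` of degree `d(a) ∨ d(b)` extends both `a` and `b`, because prefixes of one path
are ordered by their degrees. -/
theorem exists_mem_MCE (hP : IsQuasiLatticeOrdered P) (hd : IsPGraph d) {a b c : Arrow Λ}
    (ha : Prefix a c) (hb : Prefix b c) : ∃ e ∈ MCE d a b, Prefix e c := by
  obtain ⟨r, hr⟩ := hP.exists_join (deg d a.hom) (deg d b.hom)
    ⟨deg d c.hom, deg_mem d _, ha.deg_le d, hb.deg_le d⟩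
  obtain ⟨e, he, rfl⟩ :=
    hd.exists_prefix hr.mem (hr.least _ (deg_mem d c.hom) (ha.deg_le d) (hb.deg_le d))
  exact ⟨e, ⟨hr, hd.prefix_of_le ha he hr.left, hd.prefix_of_le hb he hr.right⟩, he⟩

theorem IsJoin.unique (hP : IsQuasiLatticeOrdered P) {p q r r' : G} (h : IsJoin P p q r)
    (h' : IsJoin P p q r') : r = r' :=
  hP.le_antisymm (h.least _ h'.mem h'.left h'.right) (h'.least _ h.mem h.left h.right)

theorem MCE_unique (hP : IsQuasiLatticeOrdered P) (hd : IsPGraph d) {a b c e e' : Arrow Λ}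
    (h : e ∈ MCE d a b) (h' : e' ∈ MCE d a b) (he : Prefix e c) (he' : Prefix e' c) : e = e' :=
  hd.prefix_eq he he' (h.1.unique hP h'.1)

theorem nonempty_MCE_iff (hP : IsQuasiLatticeOrdered P) (hd : IsPGraph d) {a b : Arrow Λ} :
    (MCE d a b).Nonempty ↔ Compat a b :=
  ⟨fun ⟨_, h⟩ => compat_of_mem_MCE h, fun ⟨_, h1, h2⟩ =>
    let ⟨e, he, _⟩ := exists_mem_MCE hP hd h1 h2; ⟨e, he⟩⟩

theorem mem_MCE_of_prefix {a b : Arrow Λ} (h : Prefix a b) : b ∈ MCE d a b :=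
  ⟨⟨deg_mem d _, h.deg_le d, .refl P _, fun _ _ _ h => h⟩, h, .refl b⟩

theorem MCE_eq_of_prefix (hP : IsQuasiLatticeOrdered P) (hd : IsPGraph d) {a b c : Arrow Λ}
    (h : Prefix a b) (hc : c ∈ MCE d a b) : c = b :=
  (hd.prefix_eq hc.2.2 (.refl c) (mem_MCE_of_prefix (d := d) h |>.1.unique hP hc.1)).symm

theorem prefix_comp_iff (hd : IsPGraph d) {x y z z' : Λ} {μ : x ⟶ y} {α : z ⟶ x} {β : z' ⟶ x} :
    Prefix (Arrow.mk (α ≫ μ)) (Arrow.mk (β ≫ μ)) ↔ Prefix (Arrow.mk α) (Arrow.mk β) := by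
  constructor
  · rintro ⟨z'', γ, h⟩
    exact ⟨z'', γ, hd.left_cancel_mk (h.trans (by simp : _ = Arrow.mk ((γ ≫ α) ≫ μ)))⟩
  · rintro ⟨z'', γ, h⟩
    exact ⟨z'', γ, (mk_comp_congr μ h).trans (by simp)⟩

theorem compat_comp_iff (hd : IsPGraph d) {x y z z' : Λ} {μ : x ⟶ y} {α : z ⟶ x} {β : z' ⟶ x} :
    Compat (Arrow.mk (α ≫ μ)) (Arrow.mk (β ≫ μ)) ↔ Compat (Arrow.mk α) (Arrow.mk β) := by
  constructor
  · rintro ⟨_, ⟨w, γ, rfl⟩, h⟩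
    refine ⟨Arrow.mk (γ ≫ α), .comp _ _, (prefix_comp_iff hd (μ := μ)).1 ?_⟩
    simpa using h
  · rintro ⟨_, ⟨w, γ, rfl⟩, h⟩
    refine ⟨Arrow.mk ((γ ≫ α) ≫ μ), ?_, (prefix_comp_iff hd).2 h⟩
    exact (prefix_comp_iff hd).2 (.comp _ _)

/-- `c = aα` and `c' = bα` for some path `α`. -/
def Transfer (a b c c' : Arrow Λ) : Prop :=
  ∃ (x y y' z : Λ) (μ : x ⟶ y) (ν : x ⟶ y') (α : z ⟶ x), a = Arrow.mk μ ∧ b = Arrow.mk ν ∧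
    c = Arrow.mk (α ≫ μ) ∧ c' = Arrow.mk (α ≫ ν)

theorem Transfer.symm {a b c c' : Arrow Λ} (h : Transfer a b c c') : Transfer b a c' c := by
  obtain ⟨x, y, y', z, μ, ν, α, h1, h2, h3, h4⟩ := h
  exact ⟨x, y', y, z, ν, μ, α, h2, h1, h4, h3⟩

theorem Transfer.prefix_left {a b c c' : Arrow Λ} (h : Transfer a b c c') : Prefix a c := by
  obtain ⟨x, y, y', z, μ, ν, α, rfl, rfl, rfl, rfl⟩ := h
  exact .comp _ _

theorem Transfer.deg_eq {a b c c' : Arrow Λ} (h : Transfer a b c c')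
    (hab : deg d a.hom = deg d b.hom) : deg d c.hom = deg d c'.hom := by
  obtain ⟨x, y, y', z, μ, ν, α, rfl, rfl, rfl, rfl⟩ := h
  simp only [Arrow.mk_hom] at hab ⊢
  rw [deg_comp, deg_comp, hab]

theorem Transfer.unique (hd : IsPGraph d) {a b c c' c'' : Arrow Λ} (h : Transfer a b c c')
    (h' : Transfer a b c c'') : c' = c'' := by
  obtain ⟨x, y, y', z, μ, ν, α, rfl, rfl, rfl, rfl⟩ := h
  obtain ⟨x₁, y₁, y₁', z₁, μ₁, ν₁, α₁, h1, h2, h3, rfl⟩ := h'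
  obtain rfl : x = x₁ := congrArg (fun a : Arrow Λ => a.left) h1
  obtain rfl : y = y₁ := congrArg (fun a : Arrow Λ => a.right) h1
  obtain rfl : y' = y₁' := congrArg (fun a : Arrow Λ => a.right) h2
  obtain rfl := Arrow.mk_injective _ _ h1
  obtain rfl := Arrow.mk_injective _ _ h2
  exact mk_comp_congr _ (hd.left_cancel_mk h3)

theorem Transfer.trans (hd : IsPGraph d) {a b e c c' c'' : Arrow Λ} (h : Transfer a b c c')
    (h' : Transfer b e c' c'') : Transfer a e c c'' := by
  obtain ⟨x, y, y', z, μ, ν, α, rfl, rfl, rfl, rfl⟩ := h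
  obtain ⟨x₁, y₁, y₁', z₁, μ₁, ν₁, α₁, h1, rfl, h3, rfl⟩ := h'
  obtain rfl : x = x₁ := congrArg (fun a : Arrow Λ => a.left) h1
  obtain rfl : y' = y₁ := congrArg (fun a : Arrow Λ => a.right) h1
  obtain rfl := Arrow.mk_injective _ _ h1
  exact ⟨x, _, _, _, μ, ν₁, α, rfl, rfl, rfl, (mk_comp_congr _ (hd.left_cancel_mk h3)).symm⟩

theorem Transfer.through (hd : IsPGraph d) {a b c c' e : Arrow Λ} (h : Transfer a b c c')
    (ha : Prefix a e) (hc : Prefix e c) : ∃ e', Transfer a b e e' ∧ Transfer e e' c c' := by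
  obtain ⟨x, y, y', z, μ, ν, α, rfl, rfl, rfl, rfl⟩ := h
  obtain ⟨z', β, rfl⟩ := ha
  obtain ⟨z'', γ, h⟩ := (prefix_comp_iff hd (μ := μ)).1 hc
  obtain rfl : z = z'' := congrArg (fun a : Arrow Λ => a.left) h
  obtain rfl := Arrow.mk_injective _ _ h
  refine ⟨Arrow.mk (β ≫ ν), ⟨_, _, _, _, μ, ν, β, rfl, rfl, rfl, rfl⟩,
    ⟨_, _, _, _, β ≫ μ, β ≫ ν, γ, rfl, rfl, by simp, by simp⟩⟩

/-- A set of paths is closed if it contains the minimal common extensions of its members, and `να`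
whenever it contains `μ`, `ν`, `μα` and `d(μ) = d(ν)`. -/
structure PathClosed (d : Λ ⥤ SingleObj P) (F : Set (Arrow Λ)) : Prop where
  mce : ∀ a ∈ F, ∀ b ∈ F, MCE d a b ⊆ F
  transfer : ∀ a ∈ F, ∀ b ∈ F, deg d a.hom = deg d b.hom → ∀ c ∈ F, ∀ c', Transfer a b c c' → c' ∈ F

/-- Closing under both operations could go on forever, so the set is built degree by degree: a
maximal `p ∈ D` is removed, and the paths of degree `p` are added to the closed set `F` of the
remaining degrees. These are the needed members of `E` and minimal common extensions (`G₀`) and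
their transfers along `F` (`G₁`). One round of transfers suffices. Joins are required only below a
bound in `D`, a condition that survives the removal of `p`. -/
theorem exists_finite_relClosed (hP : IsQuasiLatticeOrdered P) (hd : IsPGraph d)
    (hfa : FinitelyAligned d) {E : Set (Arrow Λ)} (hE : E.Finite) (n : ℕ) :
    ∀ D : Finset G, D.card = n → (∀ p ∈ D, p ∈ P) →
      (∀ p ∈ D, ∀ q ∈ D, ∀ t ∈ D, Le P p t → Le P q t → ∀ r, IsJoin P p q r → r ∈ D) →
    ∃ F : Set (Arrow Λ), F.Finite ∧ (∀ a ∈ F, deg d a.hom ∈ D) ∧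
      (∀ a ∈ E, deg d a.hom ∈ D → a ∈ F) ∧
      (∀ a ∈ F, ∀ b ∈ F, ∀ c ∈ MCE d a b, deg d c.hom ∈ D → c ∈ F) ∧
      (∀ a ∈ F, ∀ b ∈ F, deg d a.hom = deg d b.hom → ∀ c ∈ F, ∀ c', Transfer a b c c' → c' ∈ F) := by
  classical
  induction n with
  | zero =>
    intro D hD _ _
    rw [Finset.card_eq_zero] at hD
    subst hD
    exact ⟨∅, by simp⟩
  | succ n ih =>
    intro D hD hDP hjoin
    let _ : PartialOrder G :=
      { le := Le P
        le_refl := Le.refl P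
        le_trans := fun _ _ _ => Le.trans
        le_antisymm := fun _ _ => hP.le_antisymm }
    obtain ⟨p, hpD, hpmax⟩ := D.exists_maximal (Finset.card_pos.1 (by omega))
    have hmax : ∀ q ∈ D, Le P p q → q = p := fun q hq h => hP.le_antisymm (hpmax hq h) h
    obtain ⟨F, hF, hFD, hFE, hFM, hFT⟩ := ih (D.erase p) (by
        rw [Finset.card_erase_of_mem hpD, hD]; rfl)
      (fun q hq => hDP q (Finset.mem_of_mem_erase hq)) (by
        intro q hq q' hq' t ht h h' r hr
        rw [Finset.mem_erase] at hq hq' ht ⊢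
        refine ⟨?_, hjoin q hq.2 q' hq'.2 t ht.2 h h' r hr⟩
        rintro rfl
        exact ht.1 (hmax t ht.2 (hr.least t (hDP t ht.2) h h')))
    simp only [Finset.mem_erase] at hFD hFE hFM
    let G₀ : Set (Arrow Λ) :=
      {c | deg d c.hom = p ∧ (c ∈ E ∨ ∃ a ∈ F, ∃ b ∈ F, c ∈ MCE d a b)}
    let G₁ : Set (Arrow Λ) :=
      {c' | ∃ a ∈ F, ∃ b ∈ F, ∃ c ∈ G₀, deg d a.hom = deg d b.hom ∧ Transfer a b c c'}
    have hG₀ : G₀.Finite := by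
      refine (hE.union (hF.biUnion fun a _ => hF.biUnion fun b _ => hfa a b)).subset ?_
      rintro c ⟨-, h | ⟨a, ha, b, hb, h⟩⟩
      · exact .inl h
      · exact .inr (Set.mem_biUnion ha (Set.mem_biUnion hb h))
    have hG₁ : G₁.Finite := by
      refine (hF.biUnion fun a _ => hF.biUnion fun b _ => hG₀.biUnion fun c _ =>
        (Set.Subsingleton.finite (s := {c' | Transfer a b c c'}) fun _ h _ h' =>
          h.unique hd h')).subset ?_
      rintro c' ⟨a, ha, b, hb, c, hc, -, h⟩
      exact Set.mem_biUnion ha (Set.mem_biUnion hb (Set.mem_biUnion hc h))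
    have hG : ∀ c ∈ G₀ ∪ G₁, deg d c.hom = p := by
      rintro c (hc | ⟨a, ha, b, hb, c₀, hc, h, ht⟩)
      · exact hc.1
      · rw [← ht.deg_eq h, hc.1]
    have hFp : ∀ a ∈ F ∪ (G₀ ∪ G₁), deg d a.hom ∈ D := by
      rintro a (ha | ha)
      · exact (hFD a ha).2
      · rwa [hG a ha]
    have hFG : ∀ a ∈ F ∪ (G₀ ∪ G₁), deg d a.hom ≠ p → a ∈ F := by
      rintro a (ha | ha) h
      · exact ha
      · exact absurd (hG a ha) h
    have hGp : ∀ a ∈ F ∪ (G₀ ∪ G₁), deg d a.hom = p → a ∈ G₀ ∪ G₁ := by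
      rintro a (ha | ha) h
      · exact absurd h (hFD a ha).1
      · exact ha
    have hpre : ∀ a ∈ F ∪ (G₀ ∪ G₁), ∀ c : Arrow Λ, deg d c.hom ∈ D → Prefix a c →
        deg d a.hom = p → a = c := fun a ha c hc hac h =>
      hd.prefix_eq hac (.refl c) (h.trans (hmax _ hc (h ▸ hac.deg_le d)).symm)
    refine ⟨F ∪ (G₀ ∪ G₁), hF.union (hG₀.union hG₁), hFp, ?_, ?_, ?_⟩
    · intro a ha haD
      by_cases h : deg d a.hom = p
      · exact .inr (.inl ⟨h, .inl ha⟩)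
      · exact .inl (hFE a ha ⟨h, haD⟩)
    · intro a ha b hb c hc hcD
      by_cases h1 : deg d a.hom = p
      · rwa [← hpre a ha c hcD hc.2.1 h1]
      by_cases h2 : deg d b.hom = p
      · rwa [← hpre b hb c hcD hc.2.2 h2]
      by_cases h : deg d c.hom = p
      · exact .inr (.inl ⟨h, .inr ⟨a, hFG a ha h1, b, hFG b hb h2, hc⟩⟩)
      · exact .inl (hFM a (hFG a ha h1) b (hFG b hb h2) c hc ⟨h, hcD⟩)
    · intro a ha b hb hab c hc c' ht
      by_cases h1 : deg d a.hom = p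
      · have h2 := hpre a ha c (hFp c hc) ht.prefix_left h1
        have h3 : b = c' := hd.prefix_eq ht.symm.prefix_left (.refl c')
          (by rw [← ht.deg_eq hab, ← h2, hab])
        rwa [← h3]
      have ha' := hFG a ha h1
      have hb' := hFG b hb (hab ▸ h1)
      by_cases h : deg d c.hom = p
      swap
      · exact .inl (hFT a ha' b hb' hab c (hFG c hc h) c' ht)
      rcases hGp c hc h with hc0 | ⟨a₀, ha₀, b₀, hb₀, c₀, hc₀, hab₀, ht₀⟩
      · exact .inr (.inr ⟨a, ha', b, hb', c, hc0, hab, ht⟩)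
      -- Two successive transfers `c₀ → c → c'` are fused. Either `c` is itself the minimal common
      -- extension of `b₀` and `a`, hence in `G₀`, or that extension `e` is in `F`; its own
      -- transfers `e₀` and `e'` are then in `F`, and `e₀ → e'` takes `c₀` to `c'` directly.
      obtain ⟨e, he, hec⟩ := exists_mem_MCE hP hd ht₀.symm.prefix_left ht.prefix_left
      have heD : deg d e.hom ∈ D := hjoin _ (hFD _ hb₀).2 _ (hFD _ ha').2 _ (hFp c hc)
        (ht₀.symm.prefix_left.deg_le d) (ht.prefix_left.deg_le d) _ he.1
      by_cases hep : deg d e.hom = p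
      · have : e = c := hd.prefix_eq hec (.refl c) (hep.trans h.symm)
        subst this
        exact .inr (.inr ⟨a, ha', b, hb', e, ⟨h, .inr ⟨b₀, hb₀, a, ha', he⟩⟩, hab, ht⟩)
      have heF := hFM _ hb₀ _ ha' e he ⟨hep, heD⟩
      obtain ⟨e₀, h3, h4⟩ := ht₀.symm.through hd he.2.1 hec
      obtain ⟨e', h5, h6⟩ := ht.through hd he.2.2 hec
      refine .inr (.inr ⟨e₀, hFT _ hb₀ _ ha₀ hab₀.symm e heF e₀ h3,
        e', hFT _ ha' _ hb' hab e heF e' h5, c₀, hc₀, ?_, h4.symm.trans hd h6⟩)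
      rw [← h3.deg_eq hab₀.symm, h5.deg_eq hab]

theorem exists_finite_pathClosed (hP : IsQuasiLatticeOrdered P) (hd : IsPGraph d)
    (hfa : FinitelyAligned d) {E : Set (Arrow Λ)} (hE : E.Finite) :
    ∃ F : Set (Arrow Λ), F.Finite ∧ E ⊆ F ∧ PathClosed d F := by
  classical
  obtain ⟨D, hD, hED, hDP, hDj⟩ := hP.exists_finite_joinClosed
    (hE.image fun a : Arrow Λ => deg d a.hom)
    (by rintro _ ⟨a, -, rfl⟩; exact deg_mem d a.hom)
  obtain ⟨F, hF, hFD, hEF, hM, hT⟩ := exists_finite_relClosed hP hd hfa hE _ hD.toFinset rfl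
    (by simpa using hDP) (by simpa using fun p hp q hq _ _ _ _ r hr => hDj p hp q hq r hr)
  refine ⟨F, hF, fun a ha => hEF a ha (by simpa using hED ⟨a, ha, rfl⟩), ?_, hT⟩
  intro a ha b hb c hc
  have h1 := hFD a ha
  have h2 := hFD b hb
  simp only [Set.Finite.mem_toFinset] at h1 h2
  exact hM a ha b hb c hc (by simpa using hDj _ h1 _ h2 _ hc.1)

end Paths

/-! ### Cutting by commuting idempotents -/

section Cutting

variable {R ι : Type*} [Ring R]

/-- Since `c w = c e w + (c - c e) w`, one of the two refinements of `c` keeps `w` nonzero;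
commutation preserves what was arranged for earlier idempotents. -/
theorem exists_left_cut (e : ι → R) (he : ∀ i, e i * e i = e i) (hc : ∀ i j, e i * e j = e j * e i)
    (S : Finset ι) {w : R} (hw : w ≠ 0) : ∃ c : R, c * w ≠ 0 ∧ ∀ i ∈ S, c * e i = c ∨ c * e i = 0 := by
  classical
  induction S using Finset.induction_on with
  | empty => exact ⟨1, by simpa using hw, by simp⟩
  | insert i S _ ih =>
    obtain ⟨c, h, hS⟩ := ih
    have key : ∀ c' : R, c' = c * e i ∨ c' = c - c * e i → ∀ j ∈ insert i S,
        c' * e j = c' ∨ c' * e j = 0 := by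
      intro c' hc' j hj
      rcases Finset.mem_insert.1 hj with rfl | hj
      · rcases hc' with rfl | rfl
        · exact .inl (by rw [mul_assoc, he])
        · exact .inr (by rw [sub_mul, mul_assoc, he, sub_self])
      · have h2 : c * e i * e j = c * e j * e i := by rw [mul_assoc, hc, mul_assoc]
        rcases hS j hj with h1 | h1 <;> rcases hc' with rfl | rfl
        · exact .inl (by rw [h2, h1])
        · exact .inl (by rw [sub_mul, h2, h1])
        · exact .inr (by rw [h2, h1, zero_mul])
        · exact .inr (by rw [sub_mul, h2, h1, zero_mul, sub_self])
    by_cases h0 : c * e i * w = 0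
    · exact ⟨c - c * e i, by rwa [sub_mul, h0, sub_zero], key _ (.inr rfl)⟩
    · exact ⟨c * e i, h0, key _ (.inl rfl)⟩

theorem exists_right_cut (e : ι → R) (he : ∀ i, e i * e i = e i)
    (hc : ∀ i j, e i * e j = e j * e i) (S : Finset ι) {w : R} (hw : w ≠ 0) :
    ∃ c : R, w * c ≠ 0 ∧ ∀ i ∈ S, e i * c = c ∨ e i * c = 0 := by
  obtain ⟨c, h, hS⟩ := exists_left_cut (fun i => MulOpposite.op (e i))
    (fun i => by rw [← MulOpposite.op_mul, he])
    (fun i j => by rw [← MulOpposite.op_mul, ← MulOpposite.op_mul, hc]) S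
    (w := MulOpposite.op w) (by simpa using hw)
  refine ⟨c.unop, fun h0 => h (MulOpposite.unop_injective (by simpa using h0)), fun i hi => ?_⟩
  exact (hS i hi).imp (fun h => by simpa using congrArg MulOpposite.unop h)
    (fun h => by simpa using congrArg MulOpposite.unop h)

end Cutting

/-! ### Products of generators -/

section Products

variable {G : Type g} [Group G] {P : Submonoid G} {Λ : Type u} [Category.{v} Λ]
  {d : Λ ⥤ SingleObj P}

theorem exists_prefix_bound {A : Set (Arrow Λ)} (hA : A.Nonempty)
    (hdir : ∀ a ∈ A, ∀ b ∈ A, ∃ c ∈ A, Prefix a c ∧ Prefix b c) {T : Set (Arrow Λ)}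
    (hT : T.Finite) (hTA : T ⊆ A) : ∃ m ∈ A, ∀ a ∈ T, Prefix a m := by
  induction T, hT using Set.Finite.induction_on with
  | empty => exact ⟨hA.some, hA.some_mem, by simp⟩
  | insert _ _ ih =>
    rw [Set.insert_subset_iff] at hTA
    obtain ⟨m, hm, h⟩ := ih hTA.2
    obtain ⟨m', hm', h1, h2⟩ := hdir _ hTA.1 _ hm
    refine ⟨m', hm', ?_⟩
    rintro a (rfl | ha)
    · exact h1
    · exact (h a ha).trans h2

theorem BalPair.ext_mk {p q : BalPair d} (h1 : Arrow.mk p.fst = Arrow.mk q.fst)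
    (h2 : Arrow.mk p.snd = Arrow.mk q.snd) : p = q := by
  obtain ⟨x, y, y', μ, ν, h⟩ := p
  obtain ⟨x₁, y₁, y₁', μ₁, ν₁, h'⟩ := q
  dsimp only at h1 h2
  obtain rfl : x = x₁ := congrArg (fun a : Arrow Λ => a.left) h1
  obtain rfl : y = y₁ := congrArg (fun a : Arrow Λ => a.right) h1
  obtain rfl : y' = y₁' := congrArg (fun a : Arrow Λ => a.right) h2
  obtain rfl := Arrow.mk_injective _ _ h1
  obtain rfl := Arrow.mk_injective _ _ h2
  rfl

theorem Transfer.extend {a b c c' e e' : Arrow Λ} (h : Transfer a b c c')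
    (h' : Transfer c c' e e') : Transfer a b e e' := by
  obtain ⟨x, y, y', z, μ, ν, α, rfl, rfl, rfl, rfl⟩ := h
  obtain ⟨x₁, y₁, y₁', z₁, μ₁, ν₁, α₁, h1, h2, rfl, rfl⟩ := h'
  obtain rfl : z = x₁ := congrArg (fun a : Arrow Λ => a.left) h1
  obtain rfl : y = y₁ := congrArg (fun a : Arrow Λ => a.right) h1
  obtain rfl : y' = y₁' := congrArg (fun a : Arrow Λ => a.right) h2
  obtain rfl := Arrow.mk_injective _ _ h1
  obtain rfl := Arrow.mk_injective _ _ h2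
  exact ⟨_, _, _, _, μ, ν, α₁ ≫ α, rfl, rfl, by simp, by simp⟩

theorem BalPair.exists_transfer (p : BalPair d) {m : Arrow Λ} (h : Prefix (Arrow.mk p.fst) m) :
    ∃ n, Transfer (Arrow.mk p.fst) (Arrow.mk p.snd) m n := by
  obtain ⟨z, α, rfl⟩ := h
  exact ⟨_, _, _, _, _, p.fst, p.snd, α, rfl, rfl, rfl, rfl⟩

/-- The pair `(μα, να)`. -/
def BalPair.extend (p : BalPair d) {z : Λ} (α : z ⟶ p.src) : BalPair d :=
  ⟨z, p.rng₁, p.rng₂, α ≫ p.fst, α ≫ p.snd, by rw [deg_comp, deg_comp, p.deg_eq]⟩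

theorem BalPair.exists_extend (p : BalPair d) {m n : Arrow Λ}
    (h : Transfer (Arrow.mk p.fst) (Arrow.mk p.snd) m n) :
    ∃ (z : Λ) (α : z ⟶ p.src), m = Arrow.mk (p.extend α).fst ∧ n = Arrow.mk (p.extend α).snd := by
  obtain ⟨x, y, y₁, μ, ν, h0⟩ := p
  obtain ⟨x₁, y', y₁', z₁, μ₁, ν₁, α₁, h1, h2, rfl, rfl⟩ := h
  dsimp only at h1 h2
  obtain rfl : x = x₁ := congrArg (fun a : Arrow Λ => a.left) h1
  obtain rfl : y = y' := congrArg (fun a : Arrow Λ => a.right) h1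
  obtain rfl : y₁ = y₁' := congrArg (fun a : Arrow Λ => a.right) h2
  obtain rfl := Arrow.mk_injective _ _ h1
  obtain rfl := Arrow.mk_injective _ _ h2
  exact ⟨z₁, α₁, rfl, rfl⟩

namespace BalRep

variable {A : Type*} [NonUnitalCStarAlgebra A] (τ : BalRep d A)

theorem mul_eq_zero_of_not_compat {p q : BalPair d}
    (h : ¬ Compat (Arrow.mk p.snd) (Arrow.mk q.fst)) : τ.toFun p * τ.toFun q = 0 := by
  have : IsEmpty (MCEIndex d p.snd q.fst) := ⟨fun i => h (compat_of_mem_MCE i.mem)⟩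
  rw [τ.mul_eq, finsum_of_isEmpty]

/-- The only minimal common extension of `ν` and `νγ` is `νγ`, so the product formula has a single
term. -/
theorem mul_extend (hP : IsQuasiLatticeOrdered P) (hd : IsPGraph d) {x y y' y'' z : Λ}
    {μ : x ⟶ y} {ν : x ⟶ y'} (h : deg d μ = deg d ν) (γ : z ⟶ x) {η : z ⟶ y''}
    (h' : deg d (γ ≫ ν) = deg d η) (h'' : deg d (γ ≫ μ) = deg d η) :
    τ.toFun ⟨x, y, y', μ, ν, h⟩ * τ.toFun ⟨z, y', y'', γ ≫ ν, η, h'⟩ =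
      τ.toFun ⟨z, y, y'', γ ≫ μ, η, h''⟩ := by
  rw [τ.mul_eq]
  let i₀ : MCEIndex d ν (γ ≫ ν) := ⟨z, γ, 𝟙 z, by simp, mem_MCE_of_prefix (.comp γ ν)⟩
  have : ∀ i : MCEIndex d ν (γ ≫ ν), i = i₀ := fun i => hd.mceIndex_injective _ _
    (MCE_eq_of_prefix hP hd (.comp γ ν) i.mem)
  let _ : Unique (MCEIndex d ν (γ ≫ ν)) := ⟨⟨i₀⟩, this⟩
  rw [finsum_unique]
  exact congrArg τ.toFun (BalPair.ext_mk rfl (by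
    change Arrow.mk (𝟙 z ≫ η) = Arrow.mk η
    rw [Category.id_comp]))

theorem diag_mul (hP : IsQuasiLatticeOrdered P) (hd : IsPGraph d) (p : BalPair d) {z : Λ}
    (α : z ⟶ p.src) : τ.toFun (diag d (p.extend α).fst) * τ.toFun p = τ.toFun (p.extend α) := by
  have h := τ.mul_extend hP hd p.deg_eq.symm α (η := α ≫ p.fst) rfl
    (by rw [deg_comp, deg_comp, p.deg_eq])
  have := congrArg star h
  rw [star_mul, τ.star_eq, τ.star_eq, τ.star_eq] at this
  exact this

theorem mul_diag (hP : IsQuasiLatticeOrdered P) (hd : IsPGraph d) (p : BalPair d) {z : Λ}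
    (α : z ⟶ p.src) : τ.toFun p * τ.toFun (diag d (p.extend α).snd) = τ.toFun (p.extend α) :=
  τ.mul_extend hP hd p.deg_eq α rfl _

theorem diag_mul_self (hP : IsQuasiLatticeOrdered P) (hd : IsPGraph d) (p : BalPair d) :
    τ.toFun (diag d p.fst) * τ.toFun p = τ.toFun p := by
  have h := τ.diag_mul hP hd p (𝟙 _)
  have h2 : p.extend (𝟙 _) = p := by simp [BalPair.extend]
  rwa [h2] at h

theorem self_mul_diag (hP : IsQuasiLatticeOrdered P) (hd : IsPGraph d) (p : BalPair d) :
    τ.toFun p * τ.toFun (diag d p.snd) = τ.toFun p := by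
  have h := τ.mul_diag hP hd p (𝟙 _)
  have h2 : p.extend (𝟙 _) = p := by simp [BalPair.extend]
  rwa [h2] at h

/-- The projection `τ_{μ,μ}` in the unitization. -/
noncomputable def proj (a : Arrow Λ) : Unitization ℂ A := (τ.toFun (diag d a.hom) : A)

theorem proj_comm (a b : Arrow Λ) : τ.proj a * τ.proj b = τ.proj b * τ.proj a := by
  rw [proj, proj, ← Unitization.inr_mul, τ.diag_mul_comm, Unitization.inr_mul]

theorem proj_idem (hP : IsQuasiLatticeOrdered P) (hd : IsPGraph d) (a : Arrow Λ) :
    τ.proj a * τ.proj a = τ.proj a := by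
  rw [proj, ← Unitization.inr_mul]
  exact congrArg _ (τ.diag_mul_self hP hd (diag d a.hom))

theorem proj_mul_proj (hd : IsPGraph d) (hfa : FinitelyAligned d) (a b : Arrow Λ) :
    ∃ T : Finset (Arrow Λ), ↑T ⊆ MCE d a b ∧ τ.proj a * τ.proj b = ∑ e ∈ T, τ.proj e := by
  classical
  have := hd.finite_mceIndex hfa a.hom b.hom
  let _ := Fintype.ofFinite (MCEIndex d a.hom b.hom)
  refine ⟨Finset.univ.image fun i : MCEIndex d a.hom b.hom => Arrow.mk (i.α ≫ a.hom), ?_, ?_⟩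
  · intro e he
    simp only [Finset.coe_image, Finset.coe_univ, Set.image_univ, Set.mem_range] at he
    obtain ⟨i, rfl⟩ := he
    exact i.mem
  · rw [Finset.sum_image fun i _ j _ h => hd.mceIndex_injective _ _ h, proj, proj,
      ← Unitization.inr_mul, τ.mul_eq]
    have h1 : (∑ᶠ i : MCEIndex d (diag d a.hom).snd (diag d b.hom).fst, τ.toFun i.pair) =
        ∑ i : MCEIndex d a.hom b.hom, τ.toFun (diag d (i.α ≫ a.hom)) := by
      change (∑ᶠ i : MCEIndex d a.hom b.hom, τ.toFun (MCEIndex.pair (p := diag d a.hom)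
        (q := diag d b.hom) i)) = _
      rw [finsum_eq_sum_of_fintype]
      exact Finset.sum_congr rfl fun i _ => congrArg τ.toFun (BalPair.ext_mk rfl i.eq.symm)
    rw [h1]
    exact map_sum (Unitization.inrNonUnitalAlgHom ℂ A) _ _

end BalRep

end Products

/-! ### Linear relations between generators -/

section Kernel

variable {G : Type g} [Group G] {P : Submonoid G} {Λ : Type u} [Category.{v} Λ]
  {d : Λ ⥤ SingleObj P}

open scoped Classical in
/-- The finite set of paths `α ≠ s(μ)` such that `μα ∈ F`. -/
noncomputable def extensions (hd : IsPGraph d) {F : Set (Arrow Λ)} (hF : F.Finite) {x y : Λ}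
    (μ : x ⟶ y) : Finset (PathsTo x) :=
  ((hF.subset (Set.sdiff_subset (t := {Arrow.mk μ}))).preimage
    (f := fun α : PathsTo x => Arrow.mk (α.2 ≫ μ)) (by
      rintro ⟨z, α⟩ - ⟨z', β⟩ - h
      dsimp only at h
      obtain rfl : z = z' := congrArg (fun a : Arrow Λ => a.left) h
      rw [hd.left_cancel (Arrow.mk_injective _ _ h)])).toFinset

theorem mem_extensions (hd : IsPGraph d) {F : Set (Arrow Λ)} (hF : F.Finite) {x y : Λ}
    (μ : x ⟶ y) (α : PathsTo x) :
    α ∈ extensions hd hF μ ↔ Arrow.mk (α.2 ≫ μ) ∈ F ∧ Arrow.mk (α.2 ≫ μ) ≠ Arrow.mk μ := by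
  simp [extensions]

namespace BalRep

variable {A : Type w} [NonUnitalCStarAlgebra A] {B : Type w'} [NonUnitalCStarAlgebra B]

/-- The paths of `F` whose projection fixes `c` from the left (right) have a greatest element. -/
theorem exists_greatest_left (σ : BalRep d B) (hd : IsPGraph d)
    (hfa : FinitelyAligned d) {F : Set (Arrow Λ)} (hF : F.Finite) (hFc : PathClosed d F)
    {c : Unitization ℂ B} (hc : c ≠ 0) (hcF : ∀ a ∈ F, c * σ.proj a = c ∨ c * σ.proj a = 0)
    {a₀ : Arrow Λ} (ha₀ : a₀ ∈ F) (h₀ : c * σ.proj a₀ ≠ 0) :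
    ∃ m ∈ F, c * σ.proj m = c ∧ ∀ a ∈ F, c * σ.proj a ≠ 0 → Prefix a m := by
  have hdir : ∀ a ∈ {a ∈ F | c * σ.proj a ≠ 0}, ∀ b ∈ {a ∈ F | c * σ.proj a ≠ 0},
      ∃ e ∈ {a ∈ F | c * σ.proj a ≠ 0}, Prefix a e ∧ Prefix b e := by
    rintro a ⟨ha, ha'⟩ b ⟨hb, hb'⟩
    obtain ⟨T, hT, he⟩ := σ.proj_mul_proj hd hfa a b
    -- The product of the two projections is a sum over `MCE(a, b) ⊆ F`; as it fixes `c`, some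
    -- summand does not kill `c`, and its path extends both `a` and `b`.
    have h1 : c * (σ.proj a * σ.proj b) = c := by
      rw [← mul_assoc, (hcF a ha).resolve_right ha', (hcF b hb).resolve_right hb']
    rw [he, Finset.mul_sum] at h1
    obtain ⟨e, heT, h2⟩ := Finset.exists_ne_zero_of_sum_ne_zero (h1.trans_ne hc)
    exact ⟨e, ⟨hFc.mce a ha b hb (hT heT), h2⟩, (hT heT).2⟩
  obtain ⟨m, hm, h⟩ := exists_prefix_bound (A := {a ∈ F | c * σ.proj a ≠ 0}) ⟨a₀, ha₀, h₀⟩ hdir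
    (hF.subset (Set.sep_subset _ _)) subset_rfl
  exact ⟨m, hm.1, (hcF m hm.1).resolve_right hm.2, fun a ha h' => h a ⟨ha, h'⟩⟩

theorem exists_greatest_right (σ : BalRep d B) (hd : IsPGraph d)
    (hfa : FinitelyAligned d) {F : Set (Arrow Λ)} (hF : F.Finite) (hFc : PathClosed d F)
    {c : Unitization ℂ B} (hc : c ≠ 0) (hcF : ∀ a ∈ F, σ.proj a * c = c ∨ σ.proj a * c = 0)
    {a₀ : Arrow Λ} (ha₀ : a₀ ∈ F) (h₀ : σ.proj a₀ * c ≠ 0) :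
    ∃ m ∈ F, σ.proj m * c = c ∧ ∀ a ∈ F, σ.proj a * c ≠ 0 → Prefix a m := by
  have hstar : ∀ a, star (σ.proj a) = σ.proj a := fun a => by
    rw [proj, ← Unitization.inr_star, σ.star_eq]; rfl
  have h : ∀ a, star (σ.proj a * c) = star c * σ.proj a := fun a => by rw [star_mul, hstar]
  have h' : ∀ a, star c * σ.proj a ≠ 0 ↔ σ.proj a * c ≠ 0 := fun a => by
    rw [← h, star_ne_zero]
  obtain ⟨m, hm, h1, h2⟩ := σ.exists_greatest_left hd hfa hF hFc (star_ne_zero.2 hc)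
    (fun a ha => by rw [← h]; exact (hcF a ha).imp (fun h => by rw [h]) (fun h => by rw [h, star_zero]))
    ha₀ ((h' _).2 h₀)
  exact ⟨m, hm, star_injective (by rw [h, h1]), fun a ha h3 => h2 a ha ((h' a).2 h3)⟩

/-- Cutting down by the projections of a path `m` maximal in `F` for the cut `c` shows that the set of
proper extensions of `m` in `F` is not exhaustive. -/
theorem GapsVanish.not_exhaustive {σ : BalRep d B} (hσ : σ.GapsVanish)
    (hP : IsQuasiLatticeOrdered P) (hd : IsPGraph d) {F : Set (Arrow Λ)} (hF : F.Finite)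
    {c : Unitization ℂ B} (hc : c ≠ 0) {x y : Λ} (μ : x ⟶ y) (hm : c * σ.proj (Arrow.mk μ) = c)
    (hmax : ∀ a ∈ F, c * σ.proj a ≠ 0 → Prefix a (Arrow.mk μ)) :
    ¬ Exhaustive d (extensions hd hF μ) := by
  intro hE
  have h0 := hσ μ _ hE
  refine hc ?_
  -- Each factor fixes `c`: the projection of `μ` does, while that of a proper extension in `F`
  -- kills `c`, by the maximality of `μ`.
  have : c * σ.gapProd μ (extensions hd hF μ) = c := by
    refine Finset.noncommProd_induction _ _ _ (fun z => c * z = c)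
      (fun a b ha hb => by rw [← mul_assoc, ha, hb]) (mul_one c) fun α hα => ?_
    rw [mem_extensions] at hα
    have h1 : c * σ.proj (Arrow.mk (α.2 ≫ μ)) = 0 := by
      by_contra h
      exact hα.2 ((hmax _ hα.1 h).antisymm hP hd (.comp _ _))
    change c * ((σ.toFun (diag d μ) - σ.toFun (diag d (α.2 ≫ μ)) : B) : Unitization ℂ B) = c
    rw [Unitization.inr_sub, mul_sub]
    exact (congrArg₂ (· - ·) hm h1).trans (sub_zero c)
  rw [← this, h0, mul_zero]

-- If the compression is nonzero, `mζ` (with `m` the first path of `q`) is compatible with the first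
-- path of `p`. The minimal common extension of that path with `m` lies in `F` and is compatible
-- with `mζ`, so the choice of `ζ` forces it to be `m`. Thus `p` carries `m` to some `n₁` of the
-- degree of `n`, the second path of `q`; an extension of `n₁` is compatible with `nζ`, which forces
-- `n₁ = n`.
open scoped Classical in
theorem proj_mul_mul_proj (τ : BalRep d A) (hP : IsQuasiLatticeOrdered P) (hd : IsPGraph d)
    {F : Set (Arrow Λ)} (hF : F.Finite) (hFc : PathClosed d F) (q : BalPair d)
    (hq : Arrow.mk q.fst ∈ F) {z : Λ} (ζ : z ⟶ q.src)
    (hζ : ∀ l ∈ extensions hd hF q.fst, ¬ Compat (Arrow.mk ζ) (Arrow.mk l.2)) (p : BalPair d)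
    (hp : Arrow.mk p.fst ∈ F) :
    τ.toFun (diag d (q.extend ζ).fst) * τ.toFun p * τ.toFun (diag d (q.extend ζ).snd) =
      if Transfer (Arrow.mk p.fst) (Arrow.mk p.snd) (Arrow.mk q.fst) (Arrow.mk q.snd) then
        τ.toFun (q.extend ζ) else 0 := by
  have hqz : Transfer (Arrow.mk q.fst) (Arrow.mk q.snd) (Arrow.mk (q.extend ζ).fst)
    (Arrow.mk (q.extend ζ).snd) := ⟨_, _, _, _, q.fst, q.snd, ζ, rfl, rfl, rfl, rfl⟩
  have hmul : ∀ m n, Transfer (Arrow.mk p.fst) (Arrow.mk p.snd) m n → ∃ r : BalPair d,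
      Arrow.mk r.fst = m ∧ Arrow.mk r.snd = n ∧
        τ.toFun (diag d m.hom) * τ.toFun p = τ.toFun r := by
    intro m n h
    obtain ⟨w, α, rfl, rfl⟩ := p.exists_extend h
    exact ⟨_, rfl, rfl, τ.diag_mul hP hd p α⟩
  split_ifs with h
  · obtain ⟨r, h1, h2, h3⟩ := hmul _ _ (h.extend hqz)
    obtain rfl := BalPair.ext_mk h1 h2
    exact (congrArg (· * _) h3).trans (τ.self_mul_diag hP hd _)
  · by_contra hne
    have hcomp : Compat (Arrow.mk (q.extend ζ).fst) (Arrow.mk p.fst) := by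
      by_contra hc
      exact hne (by
        rw [τ.mul_eq_zero_of_not_compat (p := diag d (q.extend ζ).fst) hc, zero_mul])
    obtain ⟨κ, h1, h2⟩ := hcomp
    have hqκ : Prefix (Arrow.mk q.fst) κ := (Prefix.comp _ _).trans h1
    obtain ⟨e, he, heκ⟩ := exists_mem_MCE hP hd h2 hqκ
    have heq : e = Arrow.mk q.fst := by
      by_contra hne
      have heF := hFc.mce _ hp _ hq he
      obtain ⟨z', γ, rfl⟩ := he.2.2
      exact hζ ⟨z', γ⟩ ((mem_extensions hd hF _ _).2 ⟨heF, hne⟩)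
        ((compat_comp_iff hd (μ := q.fst)).1 ⟨κ, h1, heκ⟩)
    obtain ⟨n₁, ht⟩ := p.exists_transfer (heq ▸ he.2.1)
    obtain ⟨n₂, ht₂⟩ : ∃ n₂, Transfer (Arrow.mk q.fst) n₁ (Arrow.mk (q.extend ζ).fst) n₂ := by
      obtain ⟨w, α, h3, rfl⟩ := p.exists_extend ht
      rw [h3] at hqz ⊢
      exact (p.extend α).exists_transfer hqz.prefix_left
    obtain ⟨r, hr1, hr2, hr3⟩ := hmul _ _ (ht.extend ht₂)
    have hcomp : Compat n₂ (Arrow.mk (q.extend ζ).snd) := by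
      by_contra hc
      rw [← hr2] at hc
      refine hne ((congrArg (· * _) hr3).trans ?_)
      exact τ.mul_eq_zero_of_not_compat (q := diag d (q.extend ζ).snd) hc
    obtain ⟨κ', h3, h4⟩ := hcomp
    have hn : deg d n₁.hom = deg d q.snd := by
      rw [← q.deg_eq]; exact (ht.deg_eq p.deg_eq).symm
    have : n₁ = Arrow.mk q.snd := hd.prefix_eq (ht₂.symm.prefix_left.trans h3)
      ((Prefix.comp _ _).trans h4) hn
    exact h (this ▸ ht)

/-- If all gap products vanish in `σ`, then a linear relation between the `τ_{μ,ν}` with nonzero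
`τ_{μ,ν}` also holds between the `σ_{μ,ν}`. -/
theorem GapsVanish.sum_eq_zero {σ : BalRep d B} (hσ : σ.GapsVanish) {τ : BalRep d A}
    (hτ : τ.Nonvanishing) (hP : IsQuasiLatticeOrdered P) (hd : IsPGraph d)
    (hfa : FinitelyAligned d) {F : Set (Arrow Λ)} (hF : F.Finite) (hFc : PathClosed d F)
    (T : Finset (BalPair d)) (hT : ∀ p ∈ T, Arrow.mk p.fst ∈ F ∧ Arrow.mk p.snd ∈ F)
    (k : BalPair d → ℂ) (h : ∑ p ∈ T, k p • τ.toFun p = 0) : ∑ p ∈ T, k p • σ.toFun p = 0 := by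
  classical
  by_contra hw
  let U : BalPair d → Unitization ℂ B := fun p => (σ.toFun p : Unitization ℂ B)
  have hUl : ∀ p z (α : z ⟶ p.src), σ.proj (Arrow.mk (p.extend α).fst) * U p = U (p.extend α) :=
    fun p z α => by
      rw [proj, ← Unitization.inr_mul]; exact congrArg _ (σ.diag_mul hP hd p α)
  have hUr : ∀ p, U p * σ.proj (Arrow.mk p.snd) = U p := fun p => by
    rw [proj, ← Unitization.inr_mul]; exact congrArg _ (σ.self_mul_diag hP hd p)
  have hUl' : ∀ p, σ.proj (Arrow.mk p.fst) * U p = U p := fun p => by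
    rw [proj, ← Unitization.inr_mul]; exact congrArg _ (σ.diag_mul_self hP hd p)
  have hUr' : ∀ p z (α : z ⟶ p.src), U p * σ.proj (Arrow.mk (p.extend α).snd) = U (p.extend α) :=
    fun p z α => by
      rw [proj, ← Unitization.inr_mul]; exact congrArg _ (σ.mul_diag hP hd p α)
  have hw' : ∑ p ∈ T, k p • U p ≠ 0 := by
    intro h0
    apply hw
    apply Unitization.inr_injective (R := ℂ)
    rw [Unitization.inr_zero, ← h0]
    change Unitization.inrHom ℂ ℂ B _ = _
    rw [map_sum]
    exact Finset.sum_congr rfl fun p _ => by simp [U]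
  -- The cuts are taken in turn so that `c w c' ≠ 0`, where `w` is the combination in `σ`; every
  -- projection of `F` now fixes or kills `c` from the right and `c'` from the left.
  obtain ⟨c, hcw, hcF⟩ := exists_left_cut σ.proj (σ.proj_idem hP hd) σ.proj_comm hF.toFinset hw'
  obtain ⟨c', hcw', hcF'⟩ := exists_right_cut σ.proj (σ.proj_idem hP hd) σ.proj_comm
    hF.toFinset hcw
  simp only [Set.Finite.mem_toFinset] at hcF hcF'
  have hc : c ≠ 0 := by rintro rfl; simp at hcw
  have hc' : c' ≠ 0 := by rintro rfl; simp at hcw'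
  have hexp : c * (∑ p ∈ T, k p • U p) * c' = ∑ p ∈ T, k p • (c * U p * c') := by
    rw [Finset.mul_sum, Finset.sum_mul]
    exact Finset.sum_congr rfl fun p _ => by rw [mul_smul_comm, smul_mul_assoc]
  have hleft : ∀ p, c * U p * c' ≠ 0 → c * σ.proj (Arrow.mk p.fst) ≠ 0 := by
    intro p hp h0
    rw [← hUl' p, ← mul_assoc, h0, zero_mul, zero_mul] at hp
    exact hp rfl
  have hright : ∀ p, c * U p * c' ≠ 0 → σ.proj (Arrow.mk p.snd) * c' ≠ 0 := by
    intro p hp h0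
    rw [← hUr p, mul_assoc, mul_assoc, h0, mul_zero, mul_zero] at hp
    exact hp rfl
  obtain ⟨p₀, hp₀, hp₀'⟩ : ∃ p ∈ T, c * U p * c' ≠ 0 := by
    by_contra! h0
    rw [hexp, Finset.sum_eq_zero fun p hp => by rw [h0 p hp, smul_zero]] at hcw'
    exact hcw' rfl
  obtain ⟨m, hmF, hm, hmax⟩ := σ.exists_greatest_left hd hfa hF hFc hc hcF (hT p₀ hp₀).1
    (hleft p₀ hp₀')
  obtain ⟨n, hnF, hn, hnmax⟩ := σ.exists_greatest_right hd hfa hF hFc hc' hcF' (hT p₀ hp₀).2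
    (hright p₀ hp₀')
  have hleftmul : ∀ p m' n', Transfer (Arrow.mk p.fst) (Arrow.mk p.snd) m' n' →
      c * σ.proj m' = c → ∃ r : BalPair d, Arrow.mk r.fst = m' ∧ Arrow.mk r.snd = n' ∧
        c * U p * c' = c * U r * c' := by
    intro p m' n' ht hcm
    obtain ⟨z, α, rfl, rfl⟩ := p.exists_extend ht
    refine ⟨_, rfl, rfl, ?_⟩
    rw [← hUl, ← mul_assoc c, hcm]
  have hrightmul : ∀ p m' n', Transfer (Arrow.mk p.fst) (Arrow.mk p.snd) m' n' →
      σ.proj n' * c' = c' → ∃ r : BalPair d, Arrow.mk r.fst = m' ∧ Arrow.mk r.snd = n' ∧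
        c * U p * c' = c * U r * c' := by
    intro p m' n' ht hcm
    obtain ⟨z, α, rfl, rfl⟩ := p.exists_extend ht
    refine ⟨_, rfl, rfl, ?_⟩
    rw [← hUr', mul_assoc c, mul_assoc c, mul_assoc (U p), hcm]
  -- A surviving `p` carries `m` to `n₁ ⪯ n` and, backwards, `n` to `m₁ ⪯ m`. Transfer preserves
  -- degree, so `d(m) ≤ d(n) ≤ d(m)`, and therefore `n₁ = n`.
  have htransfer : ∀ p ∈ T, c * U p * c' ≠ 0 →
      Transfer (Arrow.mk p.fst) (Arrow.mk p.snd) m n := by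
    intro p hp hne
    obtain ⟨n₁, ht⟩ := p.exists_transfer (hmax _ (hT p hp).1 (hleft p hne))
    obtain ⟨m₁, ht'⟩ := p.swap.exists_transfer (hnmax _ (hT p hp).2 (hright p hne))
    replace ht' := ht'.symm
    have hn₁F := hFc.transfer _ (hT p hp).1 _ (hT p hp).2 p.deg_eq _ hmF _ ht
    have hm₁F := hFc.transfer _ (hT p hp).2 _ (hT p hp).1 p.deg_eq.symm _ hnF _ ht'.symm
    have hn₁ : Prefix n₁ n := by
      obtain ⟨r, h1, h2, h3⟩ := hleftmul p _ _ ht hm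
      subst h1 h2
      exact hnmax _ hn₁F (hright r (h3 ▸ hne))
    have hm₁ : Prefix m₁ m := by
      obtain ⟨r, h1, h2, h3⟩ := hrightmul p _ _ ht' hn
      subst h1 h2
      exact hmax _ hm₁F (hleft r (h3 ▸ hne))
    have h1 := ht.deg_eq p.deg_eq
    have h2 := ht'.deg_eq p.deg_eq
    have h3 := hn₁.deg_le d
    have h4 := hm₁.deg_le d
    rw [h2, h1] at h4
    have : n₁ = n := hd.prefix_eq hn₁ (.refl n) (hP.le_antisymm h3 h4)
    exact this ▸ ht
  obtain ⟨q, hqm, hqn, -⟩ := hleftmul p₀ _ _ (htransfer p₀ hp₀ hp₀') hm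
  subst hqm hqn
  have hval : ∀ p ∈ T, c * U p * c' =
      (if Transfer (Arrow.mk p.fst) (Arrow.mk p.snd) (Arrow.mk q.fst) (Arrow.mk q.snd)
        then (1 : ℂ) else 0) • (c * U q * c') := by
    intro p hp
    split_ifs with ht
    · obtain ⟨r, h1, h2, h3⟩ := hleftmul p _ _ ht hm
      obtain rfl := BalPair.ext_mk h1 h2
      rw [h3, one_smul]
    · rw [zero_smul]
      by_contra hne
      exact ht (htransfer p hp hne)
  have hnot := hσ.not_exhaustive hP hd hF hc q.fst hm hmax
  simp only [Exhaustive, not_forall, not_exists, not_and, nonempty_MCE_iff hP hd] at hnot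
  obtain ⟨⟨z, ζ⟩, hζ⟩ := hnot
  -- This is the scalar in front of `c U_q c'` in the cut of `w`. The same scalar multiplies the
  -- nonzero `τ_{mζ,nζ}` when the relation in `τ` is compressed.
  have hK : (∑ p ∈ T, k p * (if Transfer (Arrow.mk p.fst) (Arrow.mk p.snd) (Arrow.mk q.fst)
      (Arrow.mk q.snd) then (1 : ℂ) else 0)) = 0 := by
    have h1 := congrArg (fun a => τ.toFun (diag d (q.extend ζ).fst) * a *
      τ.toFun (diag d (q.extend ζ).snd)) h
    simp only [mul_zero, zero_mul, Finset.mul_sum, Finset.sum_mul] at h1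
    refine (smul_eq_zero.1 (?_ : _ • τ.toFun (q.extend ζ) = 0)).resolve_right (hτ _)
    rw [← h1, Finset.sum_smul]
    refine Finset.sum_congr rfl fun p hp => ?_
    rw [mul_smul_comm, smul_mul_assoc,
      τ.proj_mul_mul_proj hP hd hF hFc q hmF ζ hζ p (hT p hp).1, mul_smul, ite_smul, one_smul,
      zero_smul]
  apply hcw'
  rw [hexp, Finset.sum_congr rfl fun p hp => by rw [hval p hp, ← mul_smul], ← Finset.sum_smul, hK,
    zero_smul]

end BalRep

end Kernel

/-! ### From linear relations to homomorphisms -/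

section Homomorphisms

variable {G : Type g} [Group G] {P : Submonoid G} {Λ : Type u} [Category.{v} Λ]
  {d : Λ ⥤ SingleObj P}

namespace BalRep

variable {A : Type w} [NonUnitalCStarAlgebra A] {B : Type w'} [NonUnitalCStarAlgebra B]

instance isClosed_cstar (τ : BalRep d A) : IsClosed (τ.cstar : Set A) :=
  NonUnitalStarSubalgebra.isClosed_topologicalClosure _

theorem cstar_le (τ : BalRep d A) {S : NonUnitalStarSubalgebra ℂ A} (hS : IsClosed (S : Set A))
    (h : ∀ p, τ.toFun p ∈ S) : τ.cstar ≤ S :=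
  NonUnitalStarSubalgebra.topologicalClosure_minimal _
    (NonUnitalStarAlgebra.adjoin_le (by rintro _ ⟨p, rfl⟩; exact h p)) hS

theorem hom_ext (τ : BalRep d A) {f f' : τ.cstar →⋆ₙₐ[ℂ] B}
    (h : ∀ p, f (τ.gen p) = f' (τ.gen p)) : f = f' := by
  have hcont : ∀ f : τ.cstar →⋆ₙₐ[ℂ] B, Continuous f := fun f =>
    AddMonoidHomClass.continuous_of_bound f 1 fun a => by
      simpa using NonUnitalStarAlgHom.norm_apply_le f a
  let S : NonUnitalStarSubalgebra ℂ A :=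
    (NonUnitalStarAlgHom.equalizer f f').map (NonUnitalStarSubalgebraClass.subtype τ.cstar)
  have hS : IsClosed (S : Set A) := by
    have h1 : IsClosed {a : τ.cstar | f a = f' a} := isClosed_eq (hcont f) (hcont f')
    exact τ.isClosed_cstar.isClosedEmbedding_subtypeVal.isClosedMap _ h1
  have hle := τ.cstar_le hS fun p => ⟨τ.gen p, h p, rfl⟩
  ext a
  obtain ⟨b, hb, hba⟩ := hle a.2
  obtain rfl : b = a := Subtype.ext hba
  exact hb

/-- The algebra spanned by a set of `τ_{μ,ν}` that is closed under adjoints and products. -/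
def spanAlgebra (τ : BalRep d A) (I : Set (BalPair d)) (hswap : ∀ p ∈ I, p.swap ∈ I)
    (hmul : ∀ p ∈ I, ∀ q ∈ I, ∀ i : MCEIndex d p.snd q.fst, i.pair ∈ I) :
    NonUnitalStarSubalgebra ℂ A where
  __ := Submodule.span ℂ (τ.toFun '' I)
  mul_mem' := by
    intro a b ha hb
    induction hb using Submodule.span_induction with
    | zero => rw [mul_zero]; exact Submodule.zero_mem _
    | add b b' _ _ hb hb' => rw [mul_add]; exact Submodule.add_mem _ hb hb'
    | smul c b _ hb => rw [mul_smul_comm]; exact Submodule.smul_mem _ _ hb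
    | mem b hb =>
      obtain ⟨q, hq, rfl⟩ := hb
      induction ha using Submodule.span_induction with
      | zero => rw [zero_mul]; exact Submodule.zero_mem _
      | add b b' _ _ hb hb' => rw [add_mul]; exact Submodule.add_mem _ hb hb'
      | smul c b _ hb => rw [smul_mul_assoc]; exact Submodule.smul_mem _ _ hb
      | mem a ha =>
        obtain ⟨p, hp, rfl⟩ := ha
        rw [τ.mul_eq]
        exact finsum_induction (p := fun a => a ∈ Submodule.span ℂ (τ.toFun '' I))
          (Submodule.zero_mem _) (fun _ _ => Submodule.add_mem _)
          fun i => Submodule.subset_span ⟨_, hmul p hp q hq i, rfl⟩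
  star_mem' := by
    intro a ha
    change a ∈ Submodule.span ℂ (τ.toFun '' I) at ha
    change star a ∈ Submodule.span ℂ (τ.toFun '' I)
    induction ha using Submodule.span_induction with
    | zero => rw [star_zero]; exact Submodule.zero_mem _
    | add b b' _ _ hb hb' => rw [star_add]; exact Submodule.add_mem _ hb hb'
    | smul c b _ hb => rw [star_smul]; exact Submodule.smul_mem _ _ hb
    | mem a ha =>
      obtain ⟨p, hp, rfl⟩ := ha
      rw [τ.star_eq]
      exact Submodule.subset_span ⟨_, hswap p hp, rfl⟩

theorem mem_spanAlgebra (τ : BalRep d A) {I : Set (BalPair d)} {hswap : ∀ p ∈ I, p.swap ∈ I}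
    {hmul : ∀ p ∈ I, ∀ q ∈ I, ∀ i : MCEIndex d p.snd q.fst, i.pair ∈ I} {a : A} :
    a ∈ τ.spanAlgebra I hswap hmul ↔ a ∈ Submodule.span ℂ (τ.toFun '' I) := Iff.rfl

theorem mem_span_of_mem_adjoin (τ : BalRep d A) {a : A}
    (ha : a ∈ NonUnitalStarAlgebra.adjoin ℂ (Set.range τ.toFun)) :
    a ∈ Submodule.span ℂ (τ.toFun '' Set.univ) :=
  (NonUnitalStarAlgebra.adjoin_le (S := τ.spanAlgebra Set.univ (fun _ _ => trivial)
    fun _ _ _ _ _ => trivial) (by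
      rintro _ ⟨p, rfl⟩
      exact Submodule.subset_span ⟨p, trivial, rfl⟩) : _) ha

/-- The direct sum of two representations. -/
def prod (hd : IsPGraph d) (hfa : FinitelyAligned d) (τ : BalRep d A) (σ : BalRep d B) :
    BalRep d (A × B) where
  toFun p := (τ.toFun p, σ.toFun p)
  star_eq p := Prod.ext (τ.star_eq p) (σ.star_eq p)
  mul_eq p q := by
    have := hd.finite_mceIndex hfa p.snd q.fst
    have h1 := (AddMonoidHom.fst A B).map_finsum (f := fun i : MCEIndex d p.snd q.fst =>
      (τ.toFun i.pair, σ.toFun i.pair)) (Set.toFinite _)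
    have h2 := (AddMonoidHom.snd A B).map_finsum (f := fun i : MCEIndex d p.snd q.fst =>
      (τ.toFun i.pair, σ.toFun i.pair)) (Set.toFinite _)
    exact Prod.ext ((τ.mul_eq p q).trans h1.symm) ((σ.mul_eq p q).trans h2.symm)

variable {τ : BalRep d A} {σ : BalRep d B}

/-- The balanced pairs of paths in `F`. -/
def pairsIn (d : Λ ⥤ SingleObj P) (F : Set (Arrow Λ)) : Set (BalPair d) :=
  {p | Arrow.mk p.fst ∈ F ∧ Arrow.mk p.snd ∈ F}

theorem finite_pairsIn {F : Set (Arrow Λ)} (hF : F.Finite) : (pairsIn d F).Finite :=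
  Set.Finite.of_finite_image ((hF.prod hF).subset (by rintro _ ⟨p, hp, rfl⟩; exact hp) :
    ((fun p : BalPair d => (Arrow.mk p.fst, Arrow.mk p.snd)) '' pairsIn d F).Finite)
    fun _ _ _ _ h => BalPair.ext_mk (congrArg Prod.fst h) (congrArg Prod.snd h)

theorem pair_mem_pairsIn {F : Set (Arrow Λ)} (hF : PathClosed d F) {p q : BalPair d}
    (hp : p ∈ pairsIn d F) (hq : q ∈ pairsIn d F) (i : MCEIndex d p.snd q.fst) :
    i.pair ∈ pairsIn d F := by
  have h := hF.mce _ hp.2 _ hq.1 i.mem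
  exact ⟨hF.transfer _ hp.2 _ hp.1 p.deg_eq.symm _ h _
      ⟨_, _, _, _, p.snd, p.fst, i.α, rfl, rfl, rfl, rfl⟩,
    hF.transfer _ hq.1 _ hq.2 q.deg_eq _ (i.eq ▸ h) _
      ⟨_, _, _, _, q.fst, q.snd, i.β, rfl, rfl, rfl, rfl⟩⟩

/-- Such a `z` lies in the span of the pairs from a finite closed `F`, which is a
finite-dimensional, hence closed, `*`-algebra. The first coordinate is injective on it because
relations in `τ` hold in `σ`; it is therefore isometric for the maximum norm of `A × B`. -/
theorem GapsVanish.norm_snd_le_of_span (hσ : σ.GapsVanish) (hτ : τ.Nonvanishing)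
    (hP : IsQuasiLatticeOrdered P) (hd : IsPGraph d) (hfa : FinitelyAligned d) {z : A × B}
    (hz : z ∈ Submodule.span ℂ ((prod hd hfa τ σ).toFun '' Set.univ)) : ‖z.2‖ ≤ ‖z.1‖ := by
  obtain ⟨l, -, rfl⟩ := (Finsupp.mem_span_image_iff_linearCombination ℂ).1 hz
  obtain ⟨F, hF, hEF, hFc⟩ := exists_finite_pathClosed hP hd hfa
    (E := ((fun p : BalPair d => Arrow.mk p.fst) '' l.support) ∪
      ((fun p : BalPair d => Arrow.mk p.snd) '' l.support))
    ((l.support.finite_toSet.image _).union (l.support.finite_toSet.image _))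
  let V := (prod hd hfa τ σ).spanAlgebra (pairsIn d F) (fun p hp => ⟨hp.2, hp.1⟩)
    fun p hp q hq i => pair_mem_pairsIn hFc hp hq i
  have : FiniteDimensional ℂ (Submodule.span ℂ ((prod hd hfa τ σ).toFun '' pairsIn d F)) :=
    FiniteDimensional.span_of_finite ℂ ((finite_pairsIn hF).image _)
  have hVc : IsClosed (V : Set (A × B)) :=
    (Submodule.span ℂ ((prod hd hfa τ σ).toFun '' pairsIn d F)).closed_of_finiteDimensional
  let f : V →⋆ₙₐ[ℂ] A :=
    (NonUnitalStarAlgHom.fst ℂ A B).comp (NonUnitalStarSubalgebraClass.subtype V)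
  have hf : Function.Injective f := by
    rw [injective_iff_map_eq_zero]
    rintro ⟨z, hz⟩ h0
    obtain ⟨k, hk, rfl⟩ := (Finsupp.mem_span_image_iff_linearCombination ℂ).1
      ((mem_spanAlgebra _).1 hz)
    have h1 : ∑ p ∈ k.support, k p • τ.toFun p = 0 := by
      rw [← h0]
      change _ = (Finsupp.linearCombination ℂ (prod hd hfa τ σ).toFun k).1
      rw [Finsupp.linearCombination_apply, Finsupp.sum, Prod.fst_sum]
      rfl
    have h2 := hσ.sum_eq_zero hτ hP hd hfa hF hFc k.support (fun p hp => hk hp) k h1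
    refine Subtype.ext (Prod.ext h0 ?_)
    change (Finsupp.linearCombination ℂ (prod hd hfa τ σ).toFun k).2 = 0
    rw [← h2, Finsupp.linearCombination_apply, Finsupp.sum, Prod.snd_sum]
    rfl
  have hl : Finsupp.linearCombination ℂ (prod hd hfa τ σ).toFun l ∈ V := by
    refine (mem_spanAlgebra _).2 ((Finsupp.mem_span_image_iff_linearCombination ℂ).2 ?_)
    exact ⟨l, fun p hp => ⟨hEF (.inl ⟨p, hp, rfl⟩), hEF (.inr ⟨p, hp, rfl⟩)⟩, rfl⟩
  have h1 := NonUnitalStarAlgHom.norm_map f hf ⟨_, hl⟩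
  exact (norm_snd_le _).trans h1.ge

theorem GapsVanish.norm_snd_le (hσ : σ.GapsVanish) (hτ : τ.Nonvanishing)
    (hP : IsQuasiLatticeOrdered P) (hd : IsPGraph d) (hfa : FinitelyAligned d) {z : A × B}
    (hz : z ∈ (prod hd hfa τ σ).cstar) : ‖z.2‖ ≤ ‖z.1‖ := by
  have hcl : IsClosed {z : A × B | ‖z.2‖ ≤ ‖z.1‖} :=
    isClosed_le continuous_snd.norm continuous_fst.norm
  exact closure_minimal (fun z hz =>
    hσ.norm_snd_le_of_span hτ hP hd hfa ((prod hd hfa τ σ).mem_span_of_mem_adjoin hz)) hcl hz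

/-- If all gap products vanish in `σ` and `τ` is nonvanishing, then `τ_{μ,ν} ↦ σ_{μ,ν}` extends to a
homomorphism of `C*`-algebras. -/
theorem GapsVanish.exists_hom (hσ : σ.GapsVanish) (hτ : τ.Nonvanishing)
    (hP : IsQuasiLatticeOrdered P) (hd : IsPGraph d) (hfa : FinitelyAligned d) :
    ∃ φ : τ.cstar →⋆ₙₐ[ℂ] B, Intertwines τ σ φ := by
  let ρ := prod hd hfa τ σ
  let f : ρ.cstar →⋆ₙₐ[ℂ] A :=
    (NonUnitalStarAlgHom.fst ℂ A B).comp (NonUnitalStarSubalgebraClass.subtype ρ.cstar)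
  let f₂ : ρ.cstar →⋆ₙₐ[ℂ] B :=
    (NonUnitalStarAlgHom.snd ℂ A B).comp (NonUnitalStarSubalgebraClass.subtype ρ.cstar)
  -- The homomorphism is the second projection after the inverse of the first on `C*(τ ⊕ σ)`: the
  -- first is isometric, so its range is closed and contains `C*(τ)`.
  have hf : Isometry f := AddMonoidHomClass.isometry_of_norm f fun z =>
    le_antisymm (norm_fst_le z.1) (max_le le_rfl (hσ.norm_snd_le hτ hP hd hfa z.2))
  have hle : τ.cstar ≤ NonUnitalStarAlgHom.range f := τ.cstar_le
    (by
      rw [NonUnitalStarAlgHom.coe_range]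
      exact hf.isClosedEmbedding.isClosed_range)
    fun p => ⟨ρ.gen p, rfl⟩
  choose s hs using fun a : τ.cstar => hle a.2
  replace hs : ∀ a, f (s a) = a := hs
  have hinj := hf.injective
  refine ⟨
    { toFun := fun a => f₂ (s a)
      map_smul' := ?_
      map_zero' := ?_
      map_add' := ?_
      map_mul' := ?_
      map_star' := ?_ }, ?_⟩
  · intro c a
    have : s (c • a) = c • s a := hinj (by rw [map_smul, hs, hs]; rfl)
    rw [this, map_smul]; rfl
  · have : s 0 = 0 := hinj (by rw [map_zero, hs]; rfl)
    rw [this, map_zero]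
  · intro a b
    have : s (a + b) = s a + s b := hinj (by rw [map_add, hs, hs, hs]; rfl)
    rw [this, map_add]
  · intro a b
    have : s (a * b) = s a * s b := hinj (by rw [map_mul, hs, hs, hs]; rfl)
    rw [this, map_mul]
  · intro a
    have : s (star a) = star (s a) := hinj (by rw [map_star, hs, hs]; rfl)
    rw [this, map_star]
  · intro p
    have : s (τ.gen p) = ρ.gen p := hinj (by rw [hs]; rfl)
    change f₂ (s (τ.gen p)) = _
    rw [this]
    rfl

theorem starMap_gapProd (f : A →⋆ₙₐ[ℂ] B) (h : ∀ p, f (τ.toFun p) = σ.toFun p) {x y : Λ}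
    (μ : x ⟶ y) (E : Finset (PathsTo x)) :
    Unitization.starMap f (τ.gapProd μ E) = σ.gapProd μ E := by
  refine (Finset.map_noncommProd E _ _ (Unitization.starMap f)).trans ?_
  refine Finset.noncommProd_congr rfl (fun α _ => ?_) _
  rw [Unitization.starMap_inr, gap, gap, map_sub, h, h]

theorem GapsVanish.map (hτ : τ.GapsVanish) (f : A →⋆ₙₐ[ℂ] B) (h : ∀ p, f (τ.toFun p) = σ.toFun p) :
    σ.GapsVanish := fun μ E hE => by
  rw [← starMap_gapProd f h, hτ μ E hE, map_zero]

theorem GapsVanish.of_injective (hσ : σ.GapsVanish) (f : A →⋆ₙₐ[ℂ] B)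
    (hf : Function.Injective f) (h : ∀ p, f (τ.toFun p) = σ.toFun p) : τ.GapsVanish :=
  fun μ E hE => Unitization.starMap_injective hf (by
    rw [starMap_gapProd f h, hσ μ E hE, map_zero])

/-- A representation, regarded as a representation in the `C*`-algebra it generates. -/
def restrict (τ : BalRep d A) : BalRep d τ.cstar where
  toFun := τ.gen
  star_eq p := Subtype.ext (τ.star_eq p)
  mul_eq p q := Subtype.ext ((τ.mul_eq p q).trans (AddMonoidHom.map_finsum_of_injective
    (AddSubmonoidClass.subtype τ.cstar) Subtype.val_injective
    fun i : MCEIndex d p.snd q.fst => τ.gen i.pair).symm)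

theorem restrict_generates (τ : BalRep d A) : τ.restrict.Generates := by
  have hle := τ.cstar_le (S := NonUnitalStarSubalgebra.map
      (NonUnitalStarSubalgebraClass.subtype τ.cstar) τ.restrict.cstar)
    (τ.isClosed_cstar.isClosedEmbedding_subtypeVal.isClosedMap _ τ.restrict.isClosed_cstar)
    fun p => ⟨τ.gen p, τ.restrict.mem_cstar p, rfl⟩
  refine eq_top_iff.2 fun a _ => ?_
  obtain ⟨b, hb, hba⟩ := hle a.2
  obtain rfl : b = a := Subtype.ext hba
  exact hb

theorem Generates.mem (h : σ.Generates) (b : B) : b ∈ σ.cstar := by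
  rw [show σ.cstar = ⊤ from h]; trivial

/-- Gap products are compatible with homomorphisms, so they vanish in `τ` if `φ` is injective.
Conversely, vanishing gaps in `τ` and nonvanishing of `σ` let `exists_hom` run backwards; the
resulting map is a left inverse of `φ`, as one sees on generators. -/
theorem injective_iff_gapsVanish (hσ : σ.GapsVanish) (hσ' : σ.Nonvanishing) (hgen : σ.Generates)
    (hP : IsQuasiLatticeOrdered P) (hd : IsPGraph d) (hfa : FinitelyAligned d)
    (φ : τ.cstar →⋆ₙₐ[ℂ] B) (hφ : Intertwines τ σ φ) :
    Function.Injective φ ↔ τ.GapsVanish := by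
  constructor
  · intro h
    have h1 : τ.restrict.GapsVanish := hσ.of_injective (τ := τ.restrict) φ h hφ
    intro x y μ E hE
    exact GapsVanish.map (σ := τ) h1 (NonUnitalStarSubalgebraClass.subtype τ.cstar)
      (fun p => rfl) μ E hE
  · intro h
    obtain ⟨ψ, hψ⟩ := h.exists_hom hσ' hP hd hfa
    have key : ψ.comp (NonUnitalStarAlgHom.codRestrict φ σ.cstar fun a => hgen.mem _) =
        NonUnitalStarSubalgebraClass.subtype τ.cstar := by
      refine τ.hom_ext fun p => ?_
      refine Eq.trans ?_ (hψ p)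
      exact congrArg ψ (Subtype.ext (hφ p))
    intro a b hab
    have := congrArg (fun f => f a) key
    have h2 := congrArg (fun f => f b) key
    refine Subtype.ext (this.symm.trans (Eq.trans ?_ h2))
    exact congrArg ψ (Subtype.ext hab)

/-- A co-universal algebra is unique up to canonical isomorphism. -/
theorem existsUnique_equiv (hσ : σ.Generates) (hτ : τ.Generates)
    (f : σ.cstar →⋆ₙₐ[ℂ] A) (hf : Intertwines σ τ f) (f' : τ.cstar →⋆ₙₐ[ℂ] B)
    (hf' : Intertwines τ σ f') : ∃! e : B ≃⋆ₐ[ℂ] A, ∀ p, e (σ.toFun p) = τ.toFun p := by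
  let F : B →⋆ₙₐ[ℂ] A := f.comp (NonUnitalStarAlgHom.codRestrict (NonUnitalStarAlgHom.id ℂ B)
    σ.cstar hσ.mem)
  let F' : A →⋆ₙₐ[ℂ] B := f'.comp (NonUnitalStarAlgHom.codRestrict (NonUnitalStarAlgHom.id ℂ A)
    τ.cstar hτ.mem)
  have hF : ∀ p, F (σ.toFun p) = τ.toFun p := hf
  have hF' : ∀ p, F' (τ.toFun p) = σ.toFun p := hf'
  have h1 : ∀ b, F' (F b) = b := fun b => by
    have := σ.hom_ext (f := (F'.comp F).comp (NonUnitalStarSubalgebraClass.subtype σ.cstar))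
      (f' := NonUnitalStarSubalgebraClass.subtype σ.cstar) fun p => by
        change F' (F (σ.toFun p)) = σ.toFun p
        rw [hF, hF']
    exact congrArg (fun f => f ⟨b, hσ.mem b⟩) this
  have h2 : ∀ b, F (F' b) = b := fun b => by
    have := τ.hom_ext (f := (F.comp F').comp (NonUnitalStarSubalgebraClass.subtype τ.cstar))
      (f' := NonUnitalStarSubalgebraClass.subtype τ.cstar) fun p => by
        change F (F' (τ.toFun p)) = τ.toFun p
        rw [hF', hF]
    exact congrArg (fun f => f ⟨b, hτ.mem b⟩) this
  refine ⟨StarAlgEquiv.ofBijective F ⟨Function.LeftInverse.injective h1,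
    Function.RightInverse.surjective h2⟩, hF, fun e he => ?_⟩
  ext b
  have := σ.hom_ext (f := (e : B →⋆ₙₐ[ℂ] A).comp (NonUnitalStarSubalgebraClass.subtype σ.cstar))
    (f' := F.comp (NonUnitalStarSubalgebraClass.subtype σ.cstar)) fun p => by
      change e (σ.toFun p) = F (σ.toFun p)
      rw [he, hF]
  exact congrArg (fun f => f ⟨b, hσ.mem b⟩) this

end BalRep

end Homomorphisms

/-! ### Partial isometries of `ℓ²(X)` from partial bijections -/

section PartialBijections

variable {X : Type*}

/-- A relation that is the graph of a bijection between two subsets of `X`. -/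
structure BiUnique (r : X → X → Prop) : Prop where
  right : ∀ {x y y'}, r x y → r x y' → y = y'
  left : ∀ {x x' y}, r x y → r x' y → x = x'

open scoped Classical in
/-- The function `x ↦ f y`, where `y` is the element related to `x`. -/
noncomputable def pullback (r : X → X → Prop) (f : X → ℂ) (x : X) : ℂ :=
  if h : ∃ y, r x y then f h.choose else 0

theorem pullback_eq {r : X → X → Prop} (hr : BiUnique r) (f : X → ℂ) {x y : X} (h : r x y) :
    pullback r f x = f y := by
  have h' : ∃ y, r x y := ⟨y, h⟩
  rw [pullback, dif_pos h', hr.right h'.choose_spec h]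

theorem pullback_eq_zero {r : X → X → Prop} (f : X → ℂ) {x : X} (h : ∀ y, ¬ r x y) :
    pullback r f x = 0 := by
  rw [pullback, dif_neg (not_exists.2 h)]

theorem sum_norm_pullback_le {r : X → X → Prop} (hr : BiUnique r)
    (f : lp (fun _ : X => ℂ) 2) (s : Finset X) :
    ∑ x ∈ s, ‖pullback r f x‖ ^ (2 : ENNReal).toReal ≤ ‖f‖ ^ (2 : ENNReal).toReal := by
  classical
  have h2 : 0 < (2 : ENNReal).toReal := by norm_num
  let c : X → X := fun x => if h : ∃ y, r x y then h.choose else x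
  have hc : ∀ x, (∃ y, r x y) → r x (c x) := fun x h => by
    simp only [c, dif_pos h]; exact h.choose_spec
  calc ∑ x ∈ s, ‖pullback r f x‖ ^ (2 : ENNReal).toReal
      = ∑ x ∈ s with ∃ y, r x y, ‖f (c x)‖ ^ (2 : ENNReal).toReal := by
        rw [Finset.sum_filter]
        refine Finset.sum_congr rfl fun x _ => ?_
        split_ifs with h
        · rw [pullback_eq hr f (hc x h)]
        · rw [pullback_eq_zero f (not_exists.1 h), norm_zero, Real.zero_rpow h2.ne']
    _ = ∑ y ∈ ({x ∈ s | ∃ y, r x y} : Finset X).image c, ‖f y‖ ^ (2 : ENNReal).toReal := by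
        rw [Finset.sum_image]
        intro x hx x' hx' h
        have h1 := hc x (Finset.mem_filter.1 hx).2
        have h1' := hc x' (Finset.mem_filter.1 hx').2
        rw [← h] at h1'
        exact hr.left h1 h1'
    _ ≤ _ := lp.sum_rpow_le_norm_rpow h2 f _

/-- The partial isometry of `ℓ²(X)` given by a partial bijection of `X`. -/
noncomputable def partialIsometry {r : X → X → Prop} (hr : BiUnique r) :
    lp (fun _ : X => ℂ) 2 →L[ℂ] lp (fun _ : X => ℂ) 2 :=
  LinearMap.mkContinuous
    { toFun := fun f => ⟨pullback r f, memℓp_gen' (sum_norm_pullback_le hr f)⟩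
      map_add' := fun f f' => by
        ext x
        by_cases h : ∃ y, r x y
        · obtain ⟨y, h⟩ := h
          change pullback r _ x = pullback r _ x + pullback r _ x
          rw [pullback_eq hr _ h, pullback_eq hr _ h, pullback_eq hr _ h]
          rfl
        · change pullback r _ x = pullback r _ x + pullback r _ x
          rw [not_exists] at h
          rw [pullback_eq_zero _ h, pullback_eq_zero _ h, pullback_eq_zero _ h, add_zero]
      map_smul' := fun c f => by
        ext x
        by_cases h : ∃ y, r x y
        · obtain ⟨y, h⟩ := h
          change pullback r _ x = c * pullback r _ x
          rw [pullback_eq hr _ h, pullback_eq hr _ h]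
          rfl
        · change pullback r _ x = c * pullback r _ x
          rw [not_exists] at h
          rw [pullback_eq_zero _ h, pullback_eq_zero _ h, mul_zero] } 1
    fun f => by
      rw [one_mul]
      exact lp.norm_le_of_forall_sum_le (by norm_num) (norm_nonneg f) (sum_norm_pullback_le hr f)

theorem partialIsometry_apply {r : X → X → Prop} (hr : BiUnique r) (f : lp (fun _ : X => ℂ) 2)
    (x : X) : partialIsometry hr f x = pullback r f x := rfl

theorem star_partialIsometry {r r' : X → X → Prop} (hr : BiUnique r) (hr' : BiUnique r')
    (h : ∀ x y, r' y x ↔ r x y) : star (partialIsometry hr) = partialIsometry hr' := by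
  rw [ContinuousLinearMap.star_eq_adjoint, eq_comm, ContinuousLinearMap.eq_adjoint_iff]
  intro f f'
  rw [lp.inner_eq_tsum, lp.inner_eq_tsum]
  simp only [partialIsometry_apply]
  have hex : ∀ x : Function.support fun x => inner ℂ (f x) (pullback r f' x), ∃ y, r x y := by
    rintro ⟨x, hx⟩
    by_contra h
    exact hx (by simp [pullback_eq_zero f' (not_exists.1 h)])
  choose c hc using hex
  -- Only related pairs contribute to either inner product, so `c`, which follows the relation,
  -- matches the two supports.
  refine tsum_eq_tsum_of_ne_zero_bij c ?_ ?_ ?_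
  · intro x x' hxx
    have := hc x
    rw [hxx] at this
    exact Subtype.ext (hr.left this (hc x'))
  · intro y hy
    have : ∃ x, r' y x := by
      by_contra h
      exact hy (by simp [pullback_eq_zero f (not_exists.1 h)])
    obtain ⟨x, hx⟩ := this
    have hx' := (h x y).1 hx
    have hne : inner ℂ (f x) (pullback r f' x) ≠ 0 := by
      have : inner ℂ (pullback r' f y) (f' y) ≠ 0 := hy
      rwa [pullback_eq hr' f hx, ← pullback_eq hr f' hx'] at this
    exact ⟨⟨x, hne⟩, hr.right (hc _) hx'⟩
  · intro x
    rw [pullback_eq hr' f ((h _ _).2 (hc x)), pullback_eq hr f' (hc x)]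

end PartialBijections

/-! ### The ultrafilter representation -/

section UltraPaths

variable {G : Type g} [Group G] {P : Submonoid G} {Λ : Type u} [Category.{v} Λ]
  {d : Λ ⥤ SingleObj P}

/-- An ultrafilter of paths: a nonempty directed set of paths, closed under passing to prefixes, such
that every other path is incompatible with some member. -/
@[ext]
structure UltraPath (Λ : Type u) [Category.{v} Λ] where
  /-- the initial segments -/
  carrier : Set (Arrow Λ)
  nonempty : carrier.Nonempty
  down : ∀ {a b}, Prefix a b → b ∈ carrier → a ∈ carrier
  directed : ∀ a ∈ carrier, ∀ b ∈ carrier, ∃ c ∈ carrier, Prefix a c ∧ Prefix b c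
  ultra : ∀ a ∉ carrier, ∃ b ∈ carrier, ¬ Compat a b

namespace UltraPath

/-- Enumerate the countably many paths and, starting from `a`, extend the current path to cover the
next one whenever the two are compatible. Each path is then absorbed or incompatible with some
stage. -/
theorem exists_mem (hd : IsPGraph d) (a : Arrow Λ) : ∃ x : UltraPath Λ, a ∈ x.carrier := by
  classical
  have := hd.countable
  have : Countable (Arrow Λ) :=
    Function.Injective.countable (f := fun a : Arrow Λ =>
      (⟨a.left, a.right, a.hom⟩ : (x : Λ) × (y : Λ) × (x ⟶ y))) (by
        rintro ⟨x, y, f⟩ ⟨x', y', f'⟩ h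
        cases h
        rfl)
  have : Nonempty (Arrow Λ) := ⟨a⟩
  obtain ⟨e, he⟩ := exists_surjective_nat (Arrow Λ)
  let seq : ℕ → Arrow Λ := fun n => Nat.rec a
    (fun n m => if h : Compat m (e n) then h.choose else m) n
  have hsucc : ∀ n, seq (n + 1) = if h : Compat (seq n) (e n) then h.choose else seq n :=
    fun _ => rfl
  have hstep : ∀ n, Prefix (seq n) (seq (n + 1)) := fun n => by
    rw [hsucc]
    split_ifs with h
    · exact h.choose_spec.1
    · exact .refl _
  have hmono : ∀ n k, Prefix (seq n) (seq (n + k)) := fun n k => by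
    induction k with
    | zero => exact .refl _
    | succ k ih => exact ih.trans (hstep (n + k))
  refine ⟨⟨{b | ∃ n, Prefix b (seq n)}, ⟨a, 0, .refl a⟩, ?_, ?_, ?_⟩, 0, .refl a⟩
  · rintro b c h ⟨n, hn⟩
    exact ⟨n, h.trans hn⟩
  · rintro b ⟨n, hn⟩ c ⟨k, hk⟩
    exact ⟨seq (n + k), ⟨n + k, .refl _⟩, hn.trans (hmono n k), hk.trans (by
      rw [add_comm]; exact hmono k n)⟩
  · intro b hb
    obtain ⟨n, rfl⟩ := he b
    refine ⟨seq n, ⟨n, .refl _⟩, fun h => hb ⟨n + 1, ?_⟩⟩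
    rw [hsucc, dif_pos h.symm]
    exact h.symm.choose_spec.2

theorem exists_bound (x : UltraPath Λ) {T : Set (Arrow Λ)} (hT : T.Finite) (hTx : T ⊆ x.carrier) :
    ∃ m ∈ x.carrier, ∀ a ∈ T, Prefix a m :=
  exists_prefix_bound x.nonempty x.directed hT hTx

/-- For a pair `p = (μ, ν)`, the ultrafilters `x` and `y` are related if `x = μz` and `y = νz` for
some `z`. -/
def Match (p : BalPair d) (x y : UltraPath Λ) : Prop :=
  Arrow.mk p.fst ∈ x.carrier ∧ Arrow.mk p.snd ∈ y.carrier ∧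
    ∀ (z : Λ) (α : z ⟶ p.src),
      Arrow.mk (p.extend α).fst ∈ x.carrier ↔ Arrow.mk (p.extend α).snd ∈ y.carrier

variable {x y z : UltraPath Λ} {p q : BalPair d}

theorem match_swap : Match p.swap y x ↔ Match p x y :=
  ⟨fun h => ⟨h.2.1, h.1, fun z α => (h.2.2 z α).symm⟩,
    fun h => ⟨h.2.1, h.1, fun z α => (h.2.2 z α).symm⟩⟩

theorem Match.right_unique (h : Match p x y) (h' : Match p x z) : y = z := by
  have key : ∀ {y z : UltraPath Λ}, Match p x y → Match p x z → y.carrier ⊆ z.carrier := by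
    intro y z h h' a ha
    obtain ⟨_, hc, hac, ⟨w, α, rfl⟩⟩ := y.directed a ha _ h.2.1
    exact z.down hac ((h'.2.2 w α).1 ((h.2.2 w α).2 hc))
  exact UltraPath.ext ((key h h').antisymm (key h' h))

theorem biUnique_match (p : BalPair d) : BiUnique (Match p) :=
  ⟨Match.right_unique, fun h h' => (match_swap.2 h).right_unique (match_swap.2 h')⟩

theorem mk_comp_congr_right {x y y' z : Λ} {μ : x ⟶ y} {ν : x ⟶ y'} (γ : z ⟶ x)
    (h : Arrow.mk μ = Arrow.mk ν) : Arrow.mk (γ ≫ μ) = Arrow.mk (γ ≫ ν) := by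
  obtain rfl : y = y' := congrArg (fun a : Arrow Λ => a.right) h
  rw [Arrow.mk_injective _ _ h]

theorem Match.pair (h : Match p x y) (h' : Match q y z) (i : MCEIndex d p.snd q.fst)
    (hi : Arrow.mk (i.α ≫ p.snd) ∈ y.carrier) : Match i.pair x z := by
  refine ⟨(h.2.2 _ i.α).2 hi, (h'.2.2 _ i.β).1 (i.eq ▸ hi : Arrow.mk (i.β ≫ q.fst) ∈ y.carrier),
    fun w γ => ?_⟩
  change w ⟶ i.src at γ
  have h1 := h.2.2 w (γ ≫ i.α)
  have h2 := h'.2.2 w (γ ≫ i.β)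
  simp only [BalPair.extend, Category.assoc] at h1 h2
  rw [mk_comp_congr_right γ i.eq] at h1
  exact h1.trans h2

/-- With `p = (μ, ν)`, the prefixes of all `να` with `μα ∈ x` form the ultrafilter sought. Finite
alignment enters only in the ultrafilter property. -/
theorem exists_match (hP : IsQuasiLatticeOrdered P) (hd : IsPGraph d) (hfa : FinitelyAligned d)
    (h : Arrow.mk p.fst ∈ x.carrier) : ∃ y, Match p x y := by
  have hiff : ∀ {z z' : Λ} (α : z ⟶ p.src) (β : z' ⟶ p.src),
      Prefix (Arrow.mk (p.extend α).fst) (Arrow.mk (p.extend β).fst) ↔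
        Prefix (Arrow.mk (p.extend α).snd) (Arrow.mk (p.extend β).snd) := fun α β =>
    (prefix_comp_iff hd).trans (prefix_comp_iff hd).symm
  have hciff : ∀ {z z' : Λ} (α : z ⟶ p.src) (β : z' ⟶ p.src),
      Compat (Arrow.mk (p.extend α).fst) (Arrow.mk (p.extend β).fst) ↔
        Compat (Arrow.mk (p.extend α).snd) (Arrow.mk (p.extend β).snd) := fun α β =>
    (compat_comp_iff hd).trans (compat_comp_iff hd).symm
  let Y : Set (Arrow Λ) := {a | ∃ (z : Λ) (α : z ⟶ p.src),
    Arrow.mk (p.extend α).fst ∈ x.carrier ∧ Prefix a (Arrow.mk (p.extend α).snd)}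
  have hY : ∀ {z : Λ} (α : z ⟶ p.src),
      Arrow.mk (p.extend α).snd ∈ Y ↔ Arrow.mk (p.extend α).fst ∈ x.carrier := by
    intro z α
    constructor
    · rintro ⟨w, β, hβ, h⟩
      exact x.down ((hiff α β).2 h) hβ
    · exact fun h => ⟨z, α, h, .refl _⟩
  have hid : p.extend (𝟙 _) = p := by simp [BalPair.extend]
  have hpY : Arrow.mk p.snd ∈ Y := by
    have := (hY (𝟙 p.src)).2 (by rwa [hid])
    rwa [hid] at this
  refine ⟨⟨Y, ⟨_, hpY⟩, ?_, ?_, ?_⟩, h, hpY, fun z α => (hY α).symm⟩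
  · rintro a b hab ⟨z, α, hα, hb⟩
    exact ⟨z, α, hα, hab.trans hb⟩
  · rintro a ⟨z, α, hα, ha⟩ b ⟨z', β, hβ, hb⟩
    obtain ⟨_, hc, hαc, hβc⟩ := x.directed _ hα _ hβ
    obtain ⟨w, γ, rfl⟩ := (Prefix.comp _ _).trans hαc
    exact ⟨_, (hY γ).2 hc, ha.trans ((hiff α γ).1 hαc), hb.trans ((hiff β γ).1 hβc)⟩
  -- Suppose `a ∉ Y` is compatible with all of `Y`. For each of the finitely many `e = νγ` in
  -- `MCE(a, ν)`, `μγ ∉ x` is incompatible with some `b e ∈ x`. Let `μδ ∈ x` extend every `b e`. A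
  -- common extension of `a` and `νδ` contains one such `νγ`, so `μγ` and `μδ` are compatible: a
  -- contradiction.
  · intro a ha
    by_contra! hall
    have hfin := hfa a (Arrow.mk p.snd)
    have hinc : ∀ e ∈ MCE d a (Arrow.mk p.snd), ∃ b ∈ x.carrier, ∀ (w : Λ) (γ : w ⟶ p.src),
        e = Arrow.mk (p.extend γ).snd → ¬ Compat (Arrow.mk (p.extend γ).fst) b := by
      intro e he
      obtain ⟨w, γ, rfl⟩ := he.2.2
      have hγ : Arrow.mk (p.extend γ).fst ∉ x.carrier := fun h' =>
        ha ⟨w, γ, h', he.2.1⟩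
      obtain ⟨b, hb, hnc⟩ := x.ultra _ hγ
      refine ⟨b, hb, fun w' γ' hγ' hc => hnc ?_⟩
      have : Arrow.mk (γ ≫ p.snd) = Arrow.mk (γ' ≫ p.snd) := hγ'
      have := mk_comp_congr p.fst (hd.left_cancel_mk this)
      change Compat (Arrow.mk (γ ≫ p.fst)) b
      rw [this]
      exact hc
    have : Nonempty (Arrow Λ) := ⟨a⟩
    choose! b hbx hb using hinc
    have hsub : insert (Arrow.mk p.fst) (b '' MCE d a (Arrow.mk p.snd)) ⊆ x.carrier := by
      rw [Set.insert_subset_iff]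
      refine ⟨h, ?_⟩
      rintro _ ⟨e, he, rfl⟩
      exact hbx e he
    obtain ⟨m, hm, hbm⟩ := x.exists_bound ((hfin.image b).insert _) hsub
    obtain ⟨w, δ, rfl⟩ := hbm _ (Set.mem_insert _ _)
    obtain ⟨κ, h1, h2⟩ := hall _ ((hY δ).2 hm)
    obtain ⟨e, he, heκ⟩ := exists_mem_MCE hP hd h1 ((Prefix.comp δ p.snd).trans h2)
    have hbe := hbm (b e) (Set.mem_insert_of_mem _ ⟨e, he, rfl⟩)
    have hb' := hb e he
    obtain ⟨w', γ, rfl⟩ := he.2.2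
    exact hb' w' γ rfl (Compat.mono ((hciff γ δ).2 ⟨κ, heκ, h2⟩) (.refl _) hbe)

theorem match_diag {a b : Λ} {μ : a ⟶ b} : Match (diag d μ) x y ↔ x = y ∧ Arrow.mk μ ∈ x.carrier := by
  constructor
  · intro h
    refine ⟨?_, h.1⟩
    refine (biUnique_match (diag d μ)).right (x := x) ?_ h
    exact ⟨h.1, h.1, fun _ _ => Iff.rfl⟩
  · rintro ⟨rfl, h⟩
    exact ⟨h, h, fun _ _ => Iff.rfl⟩

end UltraPath

open UltraPath

/-- If `x` is matched to `y` by `p` and `y` to `z` by `q`, then `y` contains exactly one minimal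
common extension of the inner paths, and only its term survives. Conversely a match by any term
factors through such a `y`. -/
theorem pullback_match_mul (hP : IsQuasiLatticeOrdered P) (hd : IsPGraph d)
    (hfa : FinitelyAligned d) (p q : BalPair d) [Fintype (MCEIndex d p.snd q.fst)]
    (f : UltraPath Λ → ℂ) (x : UltraPath Λ) :
    pullback (Match p) (pullback (Match q) f) x =
      ∑ i : MCEIndex d p.snd q.fst, pullback (Match i.pair) f x := by
  by_cases hx : ∃ y z, Match p x y ∧ Match q y z
  · obtain ⟨y, z, h, h'⟩ := hx
    rw [pullback_eq (biUnique_match p) _ h, pullback_eq (biUnique_match q) _ h']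
    obtain ⟨c, hc, h1, h2⟩ := y.directed _ h.2.1 _ h'.1
    obtain ⟨e, he, hec⟩ := exists_mem_MCE hP hd h1 h2
    have hey := y.down hec hc
    obtain ⟨s, α, rfl⟩ := he.2.1
    obtain ⟨s', β, hβ⟩ := he.2.2
    obtain rfl : s = s' := congrArg (fun a : Arrow Λ => a.left) hβ
    let i₀ : MCEIndex d p.snd q.fst := ⟨s, α, β, hβ, he⟩
    rw [Fintype.sum_eq_single i₀, pullback_eq (biUnique_match _) _ (h.pair h' i₀ hey)]
    intro i hi
    refine pullback_eq_zero _ fun z' hz' => hi ?_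
    have hiy : Arrow.mk (i.α ≫ p.snd) ∈ y.carrier := (h.2.2 _ i.α).1 hz'.1
    obtain ⟨c', -, h3, h4⟩ := y.directed _ hiy _ hey
    exact hd.mceIndex_injective _ _ (MCE_unique hP hd i.mem he h3 h4)
  · rw [Finset.sum_eq_zero]
    · by_cases h : ∃ y, Match p x y
      · obtain ⟨y, h⟩ := h
        rw [pullback_eq (biUnique_match p) _ h]
        exact pullback_eq_zero _ fun z h' => hx ⟨y, z, h, h'⟩
      · exact pullback_eq_zero _ (not_exists.1 h)
    · intro i _
      refine pullback_eq_zero _ fun z hz => hx ?_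
      obtain ⟨y, hy⟩ := exists_match hP hd hfa (p := p) (x.down (Prefix.comp i.α p.fst) hz.1)
      have hiy : Arrow.mk (i.α ≫ p.snd) ∈ y.carrier := (hy.2.2 _ i.α).1 hz.1
      rw [i.eq] at hiy
      obtain ⟨z', hz'⟩ := exists_match hP hd hfa (p := q) (y.down (Prefix.comp i.β q.fst) hiy)
      exact ⟨y, z', hy, hz'⟩

/-- The representation on `ℓ²` of the space of ultrafilters of paths. -/
noncomputable def ultraRep (hP : IsQuasiLatticeOrdered P) (hd : IsPGraph d)
    (hfa : FinitelyAligned d) :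
    BalRep d (lp (fun _ : UltraPath Λ => ℂ) 2 →L[ℂ] lp (fun _ : UltraPath Λ => ℂ) 2) where
  toFun p := partialIsometry (biUnique_match p)
  star_eq p := star_partialIsometry _ _ fun _ _ => match_swap
  mul_eq p q := by
    have := hd.finite_mceIndex hfa p.snd q.fst
    let _ := Fintype.ofFinite (MCEIndex d p.snd q.fst)
    rw [finsum_eq_sum_of_fintype]
    ext f x
    rw [sum_apply, lp.coeFn_sum, Finset.sum_apply]
    exact pullback_match_mul hP hd hfa p q f x

variable (hP : IsQuasiLatticeOrdered P) (hd : IsPGraph d) (hfa : FinitelyAligned d)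

theorem ultraRep_apply (p : BalPair d) (f : lp (fun _ : UltraPath Λ => ℂ) 2) (x : UltraPath Λ) :
    (ultraRep hP hd hfa).toFun p f x = pullback (Match p) f x := rfl

theorem ultraRep_nonvanishing : (ultraRep hP hd hfa).Nonvanishing := by
  classical
  intro p h0
  obtain ⟨x, hx⟩ := UltraPath.exists_mem hd (Arrow.mk p.fst)
  obtain ⟨y, hy⟩ := exists_match hP hd hfa hx
  -- The point mass at `y` takes the value 1 at the ultrafilter `x` matched to `y`.
  have := ultraRep_apply hP hd hfa p (lp.single 2 y 1) x
  rw [h0, pullback_eq (biUnique_match p) _ hy, lp.single_apply_self] at this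
  exact zero_ne_one this

theorem ultraRep_diag_apply {a b : Λ} (μ : a ⟶ b) (f : lp (fun _ : UltraPath Λ => ℂ) 2)
    (x : UltraPath Λ) [Decidable (Arrow.mk μ ∈ x.carrier)] :
    (ultraRep hP hd hfa).toFun (diag d μ) f x = if Arrow.mk μ ∈ x.carrier then f x else 0 := by
  rw [ultraRep_apply]
  split_ifs with h
  · exact pullback_eq (biUnique_match _) _ (match_diag.2 ⟨rfl, h⟩)
  · exact pullback_eq_zero _ fun y hy => h (match_diag.1 hy).2

/-- The equivalence says that the gap of `μ` and `α` vanishes at `x`, and it includes the case `μ ∉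
x`. Otherwise every `μα` is incompatible with some member of `x`; a path `μν ∈ x` extending all
these members contradicts exhaustiveness at `ν`. -/
theorem UltraPath.exists_mem_of_exhaustive (hd : IsPGraph d) {a b : Λ} (μ : a ⟶ b) {E : Finset (PathsTo a)}
    (hE : Exhaustive d E) (x : UltraPath Λ) :
    ∃ α ∈ E, Arrow.mk μ ∈ x.carrier ↔ Arrow.mk (α.2 ≫ μ) ∈ x.carrier := by
  by_contra! hcon
  obtain ⟨l, hl, -⟩ := hE ⟨a, 𝟙 a⟩
  have hdown : ∀ α : PathsTo a, Arrow.mk (α.2 ≫ μ) ∈ x.carrier → Arrow.mk μ ∈ x.carrier :=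
    fun α => x.down (.comp _ _)
  have hμ : Arrow.mk μ ∈ x.carrier := by
    have := hcon l hl
    have := hdown l
    tauto
  have hinc : ∀ α ∈ E, ∃ b ∈ x.carrier, ¬ Compat (Arrow.mk (α.2 ≫ μ)) b := fun α hα =>
    x.ultra _ (by have := hcon α hα; tauto)
  have : Nonempty (Arrow Λ) := ⟨Arrow.mk μ⟩
  choose! b hbx hb using hinc
  have hsub : insert (Arrow.mk μ) (b '' (E : Set (PathsTo a))) ⊆ x.carrier := by
    rw [Set.insert_subset_iff]
    refine ⟨hμ, ?_⟩
    rintro _ ⟨α, hα, rfl⟩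
    exact hbx α hα
  obtain ⟨m, hm, hbm⟩ := x.exists_bound ((E.finite_toSet.image b).insert _) hsub
  obtain ⟨w, ν, rfl⟩ := hbm _ (Set.mem_insert _ _)
  obtain ⟨α, hα, e, he⟩ := hE ⟨w, ν⟩
  exact hb α hα (Compat.mono ((compat_comp_iff hd (μ := μ)).2 (compat_of_mem_MCE he)).symm (.refl _)
    (hbm _ (Set.mem_insert_of_mem _ ⟨α, hα, rfl⟩)))

theorem ultraRep_gapsVanish : (ultraRep hP hd hfa).GapsVanish := by
  classical
  intro a b μ E hE
  -- The factor that vanishes depends on the point `x`, so any chosen factor must be brought to the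
  -- front.
  have hfac : ∀ α ∈ E, ∃ R, (ultraRep hP hd hfa).gapProd μ E =
      ((ultraRep hP hd hfa).gap μ α : Unitization ℂ _) * R := fun α hα =>
    ⟨_, (Finset.mul_noncommProd_erase E hα _ _).symm⟩
  -- `L` lets the unitization act on `ℓ²`. It sends the adjoined unit to the identity operator and
  -- so is not injective; the scalar part of the product is shown to vanish separately, using `E ≠
  -- ∅`.
  let L := Unitization.lift (NonUnitalAlgHom.id ℂ
    (lp (fun _ : UltraPath Λ => ℂ) 2 →L[ℂ] lp (fun _ : UltraPath Λ => ℂ) 2))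
  have hL : L ((ultraRep hP hd hfa).gapProd μ E) = 0 := by
    ext f x
    obtain ⟨α, hα, hx⟩ := exists_mem_of_exhaustive hd μ hE x
    obtain ⟨R, hR⟩ := hfac α hα
    rw [hR, map_mul]
    have : L ((ultraRep hP hd hfa).gap μ α : Unitization ℂ _) = (ultraRep hP hd hfa).gap μ α := by
      simp [L]
    rw [this, mul_apply_eq_comp, BalRep.gap, sub_apply,
      lp.coeFn_sub, Pi.sub_apply, ultraRep_diag_apply, ultraRep_diag_apply]
    simp [hx]
  obtain ⟨l, hl, -⟩ := hE ⟨a, 𝟙 a⟩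
  obtain ⟨R, hR⟩ := hfac l hl
  have h1 : ((ultraRep hP hd hfa).gapProd μ E).fst = 0 := by
    rw [hR, Unitization.fst_mul, Unitization.fst_inr, zero_mul]
  have h2 : (ultraRep hP hd hfa).gapProd μ E =
      (((ultraRep hP hd hfa).gapProd μ E).snd : Unitization ℂ _) := Unitization.ext h1 rfl
  rw [h2] at hL ⊢
  have h3 : ((ultraRep hP hd hfa).gapProd μ E).snd = 0 := by simpa [L] using hL
  rw [h3, Unitization.inr_zero]

theorem exists_nonvanishing_gapsVanish (hP : IsQuasiLatticeOrdered P) (hd : IsPGraph d)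
    (hfa : FinitelyAligned d) :
    ∃ (B : Type (max u v)) (_ : NonUnitalCStarAlgebra B) (Ω : BalRep d B),
      Ω.Generates ∧ Ω.Nonvanishing ∧ Ω.GapsVanish := by
  refine ⟨(ultraRep hP hd hfa).cstar, inferInstance, (ultraRep hP hd hfa).restrict,
    (ultraRep hP hd hfa).restrict_generates,
    fun p h => ultraRep_nonvanishing hP hd hfa p (congrArg Subtype.val h), ?_⟩
  intro a b μ E hE
  exact BalRep.GapsVanish.of_injective (τ := (ultraRep hP hd hfa).restrict)
    (ultraRep_gapsVanish hP hd hfa) (NonUnitalStarSubalgebraClass.subtype _)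
    Subtype.val_injective (fun _ => rfl) μ E hE

end UltraPaths

end BalancedPGraph

open BalancedPGraph in
theorem mainTheorem2 {G : Type g} [Group G] (P : Submonoid G) (hP : IsQuasiLatticeOrdered P)
    {Λ : Type u} [Category.{v} Λ] (d : Λ ⥤ SingleObj P) (hd : IsPGraph d)
    (hfa : FinitelyAligned d) :
    ∃ (B : Type (max u v)) (_ : NonUnitalCStarAlgebra B) (Ω : BalRep d B),
      Ω.Generates ∧
      Ω.Nonvanishing ∧
      (∀ (A : Type w) [NonUnitalCStarAlgebra A] (τ : BalRep d A), τ.Nonvanishing →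
        ∃ φ : τ.cstar →⋆ₙₐ[ℂ] B, Intertwines τ Ω φ) ∧
      (∀ (B' : Type w) [NonUnitalCStarAlgebra B'] (Ω' : BalRep d B'),
        Ω'.Generates → Ω'.Nonvanishing →
        (∀ (A : Type (max u v)) [NonUnitalCStarAlgebra A] (τ : BalRep d A), τ.Nonvanishing →
          ∃ φ : τ.cstar →⋆ₙₐ[ℂ] B', Intertwines τ Ω' φ) →
        ∃! e : B ≃⋆ₐ[ℂ] B', ∀ p, e (Ω.toFun p) = Ω'.toFun p) ∧
      (∀ (A : Type w) [NonUnitalCStarAlgebra A] (τ : BalRep d A), τ.Nonvanishing →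
        ∀ φ : τ.cstar →⋆ₙₐ[ℂ] B, Intertwines τ Ω φ →
          (Function.Injective φ ↔ τ.GapsVanish)) := by
  obtain ⟨B, _, Ω, hgen, hnon, hgap⟩ := exists_nonvanishing_gapsVanish hP hd hfa
  refine ⟨B, _, Ω, hgen, hnon, fun A _ τ hτ => BalRep.GapsVanish.exists_hom hgap hτ hP hd hfa, ?_,
    fun A _ τ _ φ hφ => BalRep.injective_iff_gapsVanish hgap hnon hgen hP hd hfa φ hφ⟩
  intro B' _ Ω' hgen' hnon' huniv
  -- The universal property of `B'` is needed only for `τ = Ω`, so it is assumed only in the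
  -- universe of `B`.
  obtain ⟨f, hf⟩ := huniv _ _ hnon
  obtain ⟨f', hf'⟩ := BalRep.GapsVanish.exists_hom hgap hnon' hP hd hfa
  exact BalRep.existsUnique_equiv hgen hgen' f hf f' hf'
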